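/- **Setting.** Let $S:\widetilde F\to G$ be a compact linear operator between real Banach spaces (with their Borel $\sigma$-algebras) and let $F=\{f\in\widetilde F:\|f\|\le 1\}$. A Monte Carlo method of cardinality $n$ over a probability space $(\Omega,\Sigma,\mathbb P)$ is a map $A_n^\omega=\phi^\omega\circ N^\omega$ with $N^\omega:\widetilde F\to\mathbb R^n$, $\phi^\omega:\mathbb R^n\to G$, where the $k$-th entry of $N^\omega(f)=(y_1,\dots,y_n)$ is $y_k=L^\omega_{k,(y_1,\dots,y_{k-1})}(f)$ with a continuous linear functional $L^\omega_{k,(y_1,\dots,y_{k-1})}$ on $\widetilde F$ that may be chosen (measurably) depending on $\omega$ and on the previous values (adaption); $(\omega,f)\mapsto N^\omega(f)$ and $(\omega,f)\mapsto A_n^\omega(f)$ are measurable. The method is *homogeneous* if for all $\omega$ and all information vectors $y=N^\omega(f)$ one has $L^\omega_{k,\lambda(y_1,\dots,y_{k-1})}=L^\omega_{k,(y_1,\dots,y_{k-1})}$ for $\lambda\neq0$ and $\phi^\omega(\lambda y)=\lambda\,\phi^\omega(y)$ for $\lambda\in\mathbb R$. Its error is $e(A_n,S)=\sup_{f\in F}\mathbb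 E\,\|S(f)-A_n^\omega(f)\|_G$, and $e^{\mathrm{ran,hom}}(n,S)$ is the infimum of $e(A_n,S)$ over all homogeneous Monte Carlo methods of cardinality $n$ (over all probability spaces). Methods with *varying cardinality* are defined in the same way with information sequences $N^\omega(f)=(y_k)_{k\in\mathbb N}\in\mathbb R^{\mathbb N}$; their cardinality at $f$ is $n(\omega,f)=\inf\{n\in\mathbb N_0: L^\omega_{k,(y_1,\dots,y_{k-1})}=0\text{ for all }k>n\}$. For real $\bar n\ge0$, $\bar e^{\mathrm{ran,hom}}(\bar n,S)$ is the infimum of the errors $\sup_{f\in F}\mathbb E\|S(f)-A^\omega(f)\|_G$ over all homogeneous methods $A$ with $\sup_{f\in F}\mathbb E\,n(\omega,f)\le\bar n$. The Bernstein numbers are $b_m(S)=\sup_{X_m}\inf_{f\in X_m,\|f\|=1}\|S(f)\|_G$, the supremum being over the $m$-dimensional linear subspaces $X_m\subseteq\widetilde F$ (it is $0$ if $m\geq 1$ and there are none). **Theorem.** 1. For all integers $m>n\ge0$, $$e^{\mathrm{ran,hom}}(n,S)\;\ge\;\frac{m-n}{m}\,b_m(S).$$ 2. For all integers $m\ge n\ge0$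 and every injective linear $J:\ell_2^m\to\widetilde F$, $$e^{\mathrm{ran,hom}}(n,S)\;\ge\;\inf_{P}\frac{\mathbb E\|SJPX\|_G}{\mathbb E\|JX\|_{\widetilde F}},$$ where $P$ runs over the orthogonal projections of rank $m-n$ on $\ell_2^m$ and $X$ is a standard Gaussian vector in $\mathbb R^m=\ell_2^m$ (for $m=0$ the right-hand side is read as $0$). 3. For all integers $m\ge1$ and all real $\bar n\ge0$, $$\bar e^{\mathrm{ran,hom}}(\bar n,S)\;\ge\;\Bigl(\frac{m-\bar n}{m}\Bigr)_+\,b_m(S).$$ 4. The Bernstein bounds are sharp: for every $m\ge1$ the identity $\mathrm{id}$ of $\ell_1^m$ has $b_m(\mathrm{id})=1$, and $e^{\mathrm{ran,hom}}(n,\mathrm{id})=\bigl(\frac{m-n}{m}\bigr)_+$ for all integers $n\ge0$, $\bar e^{\mathrm{ran,hom}}(\bar n,\mathrm{id})=\bigl(\frac{m-\bar n}{m}\bigr)_+$ for all real $\bar n\ge0$. -/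

import Mathlib

open MeasureTheory ProbabilityTheory
open scoped ENNReal NNReal

universe u v w

noncomputable section

section Information

variable {F : Type u} [NormedAddCommGroup F] [NormedSpace ℝ F]

/-- The partial information `(y_1, …, y_k)` obtained at the input `f` by a (deterministic) adaptive
rule `L`. The functional `L k y`, chosen on the basis of the first `k` values `y`, yields the
value with number `k + 1`. -/
def partialInfo (L : (k : ℕ) → (Fin k → ℝ) → (F →L[ℝ] ℝ)) (f : F) : (k : ℕ) → (Fin k → ℝ)
  | 0 => Fin.elim0
  | k + 1 => Fin.snoc (partialInfo L f k) (L k (partialInfo L f k) f)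

/-- The whole information sequence `(y_1, y_2, …)` obtained at the input `f`. -/
def infoSequence (L : (k : ℕ) → (Fin k → ℝ) → (F →L[ℝ] ℝ)) (f : F) : ℕ → ℝ :=
  fun k => L k (partialInfo L f k) f

/-- The amount of information actually used at the input `f`: the least `n` such that all the
functionals chosen after the first `n` ones are zero (`⊤` if there is no such `n`). -/
def infoCount (L : (k : ℕ) → (Fin k → ℝ) → (F →L[ℝ] ℝ)) (f : F) : ℕ∞ :=
  ⨅ (n : ℕ) (_ : ∀ k, n ≤ k → L k (partialInfo L f k) = 0), (n : ℕ∞)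

end Information

section Methods

variable (Ω : Type w) [MeasurableSpace Ω]
  (F : Type u) [NormedAddCommGroup F] [NormedSpace ℝ F] [MeasurableSpace F]
  (G : Type v) [NormedAddCommGroup G] [NormedSpace ℝ G] [MeasurableSpace G]

/-- A Monte Carlo method of fixed cardinality `n` using arbitrary continuous linear functionals,
chosen adaptively. The functionals with index `k ≥ n` are never evaluated. -/
structure MonteCarloMethod (n : ℕ) where
  /-- the choice of the next functional, given `ω` and the first `k` values -/
  functional : Ω → (k : ℕ) → (Fin k → ℝ) → (F →L[ℝ] ℝ)
  /-- the output as a function of `ω` and the information vector -/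
  output : Ω → (Fin n → ℝ) → G
  measurable_functional : ∀ k < n, ∀ f : F,
    Measurable fun p : Ω × (Fin k → ℝ) => functional p.1 k p.2 f
  measurable_info : Measurable fun p : Ω × F => partialInfo (functional p.1) p.2 n
  measurable_output : Measurable fun p : Ω × F =>
    output p.1 (partialInfo (functional p.1) p.2 n)

/-- A Monte Carlo method with (adaptively) varying cardinality using arbitrary continuous linear
functionals, chosen adaptively. It stops by choosing the zero functional from some index on. -/
structure VaryingMonteCarloMethod where
  /-- the choice of the next functional, given `ω` and the first `k` values -/
  functional : Ω → (k : ℕ) → (Fin k → ℝ) → (F →L[ℝ] ℝ)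
  /-- the output as a function of `ω` and the information sequence -/
  output : Ω → (ℕ → ℝ) → G
  measurable_functional : ∀ k, ∀ f : F,
    Measurable fun p : Ω × (Fin k → ℝ) => functional p.1 k p.2 f
  measurable_info : Measurable fun p : Ω × F => infoSequence (functional p.1) p.2
  measurable_output : Measurable fun p : Ω × F =>
    output p.1 (infoSequence (functional p.1) p.2)

end Methods

section Errors

variable {Ω : Type w} [MeasurableSpace Ω]
  {F : Type u} [NormedAddCommGroup F] [NormedSpace ℝ F] [MeasurableSpace F]
  {G : Type v} [NormedAddCommGroup G] [NormedSpace ℝ G] [MeasurableSpace G]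

namespace MonteCarloMethod

variable {n : ℕ}

/-- The output `φ^ω (N^ω f)` of the method. -/
def eval (A : MonteCarloMethod Ω F G n) (ω : Ω) (f : F) : G :=
  A.output ω (partialInfo (A.functional ω) f n)

/-- Homogeneity: on information vectors, the choice of functionals is invariant under nonzero
scalings, and the output is homogeneous. -/
def IsHomogeneous (A : MonteCarloMethod Ω F G n) : Prop :=
  (∀ ω f, ∀ k < n, ∀ c : ℝ, c ≠ 0 →
    A.functional ω k (c • partialInfo (A.functional ω) f k) =
      A.functional ω k (partialInfo (A.functional ω) f k)) ∧
  (∀ ω f, ∀ c : ℝ,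
    A.output ω (c • partialInfo (A.functional ω) f n) =
      c • A.output ω (partialInfo (A.functional ω) f n))

/-- The worst case over the (closed) unit ball of the expected error. -/
def error (A : MonteCarloMethod Ω F G n) (P : Measure Ω) (S : F →L[ℝ] G) : ℝ≥0∞ :=
  ⨆ (f : F) (_ : f ∈ Metric.closedBall (0 : F) 1), ∫⁻ ω, ‖S f - A.eval ω f‖ₑ ∂P

end MonteCarloMethod

namespace VaryingMonteCarloMethod

/-- The output `φ^ω (N^ω f)` of the method. -/
def eval (A : VaryingMonteCarloMethod Ω F G) (ω : Ω) (f : F) : G :=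
  A.output ω (infoSequence (A.functional ω) f)

/-- Homogeneity: on information sequences, the choice of functionals is invariant under nonzero
scalings, and the output is homogeneous. -/
def IsHomogeneous (A : VaryingMonteCarloMethod Ω F G) : Prop :=
  (∀ ω f k, ∀ c : ℝ, c ≠ 0 →
    A.functional ω k (c • partialInfo (A.functional ω) f k) =
      A.functional ω k (partialInfo (A.functional ω) f k)) ∧
  (∀ ω f, ∀ c : ℝ,
    A.output ω (c • infoSequence (A.functional ω) f) =
      c • A.output ω (infoSequence (A.functional ω) f))

/-- The worst case over the (closed) unit ball of the expected error. -/
def error (A : VaryingMonteCarloMethod Ω F G) (P : Measure Ω) (S : F →L[ℝ] G) : ℝ≥0∞ :=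
  ⨆ (f : F) (_ : f ∈ Metric.closedBall (0 : F) 1), ∫⁻ ω, ‖S f - A.eval ω f‖ₑ ∂P

/-- The worst case over the (closed) unit ball of the expected cardinality. -/
def card (A : VaryingMonteCarloMethod Ω F G) (P : Measure Ω) : ℝ≥0∞ :=
  ⨆ (f : F) (_ : f ∈ Metric.closedBall (0 : F) 1),
    ∫⁻ ω, (infoCount (A.functional ω) f : ℝ≥0∞) ∂P

end VaryingMonteCarloMethod

/-- The minimal error `e^{ran,hom}(n, S)` of homogeneous Monte Carlo methods of cardinality `n`:
the infimum over all probability spaces and all methods over them. -/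
def homMonteCarloError (n : ℕ) (S : F →L[ℝ] G) : ℝ≥0∞ :=
  ⨅ (Ω : Type w) (_ : MeasurableSpace Ω) (P : Measure Ω) (_ : IsProbabilityMeasure P)
    (A : MonteCarloMethod Ω F G n) (_ : A.IsHomogeneous), A.error P S

/-- The minimal error of homogeneous Monte Carlo methods with varying cardinality whose worst case
expected cardinality is at most `nbar`. -/
def homMonteCarloErrorVarying (nbar : ℝ≥0) (S : F →L[ℝ] G) : ℝ≥0∞ :=
  ⨅ (Ω : Type w) (_ : MeasurableSpace Ω) (P : Measure Ω) (_ : IsProbabilityMeasure P)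
    (A : VaryingMonteCarloMethod Ω F G) (_ : A.IsHomogeneous) (_ : A.card P ≤ nbar), A.error P S

end Errors

/-- The Bernstein number `b_m(S)`: the supremum over all `m`-dimensional subspaces `X` of the
infimum of `‖S f‖` over the unit sphere of `X`. -/
def bernsteinNumber {F : Type u} [NormedAddCommGroup F] [NormedSpace ℝ F]
    {G : Type v} [NormedAddCommGroup G] [NormedSpace ℝ G] (S : F →L[ℝ] G) (m : ℕ) : ℝ≥0∞ :=
  ⨆ (X : Submodule ℝ F) (_ : Module.rank ℝ X = m), ⨅ (f : F) (_ : f ∈ X) (_ : ‖f‖ = 1), ‖S f‖ₑ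

end

/-! Homogeneity turns an error bound e on the unit ball into the bound ‖f‖·e for every input f, so
the unbounded random input f = JX, with X standard Gaussian, may be used. Averaging gives E‖JX‖·e as
an upper bound for the mean error at JX (`lintegral_gaussianMean_le_error`).

For the lower bound on this mean, fix ω and let K be the subspace of directions on which all
functionals chosen at JX vanish. Even for adaptive information, replacing the K-component of X by an
independent copy preserves the law of X and the information (`IsAdaptive.lintegral_resample`). The
output cannot react to this component, and by symmetry no shift does better than 0 against a centred
Gaussian, so the mean error is at least the average of E‖SJP_K Z‖.

With at most n functionals, dim K ≥ m - n. As E‖SJP_K Z‖ increases with K, the Gaussian bound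
follows. For the Bernstein bounds, ‖Sf‖ ≥ b‖f‖ on X_m, and Lewis' theorem
(`exists_automorphism_gaussianMean`) supplies a parametrization J of X_m with E‖JP_K Z‖ ≥ (dim
K/m)·E‖JZ‖ for all K. This is linear in dim K, so only the average of dim K matters and a bound on
the expected cardinality suffices.

On ℓ_1^m the bounds are attained by reading a random cyclic block of coordinates, or by tossing a
coin between full and no information. -/

/-! ### Gaussian vectors conditioned on adaptive information -/

section AdaptiveGaussian

open Filter Topology

variable {E : Type*} [NormedAddCommGroup E] [InnerProductSpace ℝ E]

/-- The vectors annihilated by all functionals `⟪a k, ·⟫` with `k ∈ s`. -/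
noncomputable def annihilatedBy (a : ℕ → E) (s : Set ℕ) : Submodule ℝ E := (Submodule.span ℝ (a '' s))ᗮ

lemma mem_annihilatedBy {a : ℕ → E} {s : Set ℕ} {v : E} :
    v ∈ annihilatedBy a s ↔ ∀ k ∈ s, inner ℝ (a k) v = 0 := by
  constructor
  · intro h k hk
    exact h _ (Submodule.subset_span ⟨k, hk, rfl⟩)
  · intro h w hw
    induction hw using Submodule.span_induction with
    | mem x hx => obtain ⟨k, hk, rfl⟩ := hx; exact h k hk
    | zero => simp
    | add x y _ _ hx hy => rw [inner_add_left, hx, hy, add_zero]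
    | smul c x _ hx => rw [inner_smul_left, hx, mul_zero]

lemma annihilatedBy_anti (a : ℕ → E) {s t : Set ℕ} (h : s ⊆ t) :
    annihilatedBy a t ≤ annihilatedBy a s := fun _ hv =>
  mem_annihilatedBy.2 fun k hk => mem_annihilatedBy.1 hv k (h hk)

lemma annihilatedBy_zero (a : ℕ → E) : annihilatedBy a (Set.Iio 0) = ⊤ := by
  ext v; simp [mem_annihilatedBy]

/-- A sequence of functionals, represented by vectors, which is chosen adaptively: the functional
with number `k` depends only on the values of the functionals chosen before. -/
def IsAdaptive (a : ℕ → E → E) : Prop :=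
  ∀ k x w, (∀ j < k, inner ℝ (a j x) (w - x) = 0) → a k w = a k x

/-- The functional with number n depends only on the n values before it, so a move invisible to the
first n functionals fixes the first n + 1 of them. This gain of one index drives the induction in
`IsAdaptive.lintegral_resample_Iio`. -/
lemma IsAdaptive.annihilatedBy_Iio_succ_eq {a : ℕ → E → E} (ha : IsAdaptive a) (n : ℕ) {x w : E}
    (h : w - x ∈ annihilatedBy (fun k => a k x) (Set.Iio n)) :
    annihilatedBy (fun k => a k w) (Set.Iio (n + 1)) =
      annihilatedBy (fun k => a k x) (Set.Iio (n + 1)) := by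
  have h1 : ∀ k ∈ Set.Iio (n + 1), a k w = a k x := fun k hk => ha k x w fun j hj =>
    mem_annihilatedBy.1 h j (lt_of_lt_of_le hj (Nat.le_of_lt_succ hk))
  ext v
  simp only [mem_annihilatedBy]
  exact forall₂_congr fun k hk => by rw [h1 k hk]

variable [FiniteDimensional ℝ E]

/-- One Gram–Schmidt step: the direction u, the part of `a n` not yet seen, is removed. If u = 0 the
new functional is redundant, and the correction term vanishes. The explicit formula is what yields
measurability in the functionals. -/
lemma starProjection_annihilatedBy_succ (a : ℕ → E) (n : ℕ) (v : E) :
    (annihilatedBy a (Set.Iio (n + 1))).starProjection v =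
      (annihilatedBy a (Set.Iio n)).starProjection v -
        (inner ℝ ((annihilatedBy a (Set.Iio n)).starProjection (a n)) v /
          ‖(annihilatedBy a (Set.Iio n)).starProjection (a n)‖ ^ 2) •
          (annihilatedBy a (Set.Iio n)).starProjection (a n) := by
  set K := annihilatedBy a (Set.Iio n) with hK
  set u := K.starProjection (a n) with hu
  have huK : u ∈ K := K.starProjection_apply_mem _
  have hau : ∀ w, inner ℝ (a n) (K.starProjection w) = inner ℝ u w := fun w => by
    rw [hu, Submodule.inner_starProjection_left_eq_right]
  have huu : inner ℝ (a n) u = ‖u‖ ^ 2 := by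
    have h := hau u
    rwa [Submodule.starProjection_eq_self_iff.2 huK, real_inner_self_eq_norm_sq] at h
  refine Submodule.eq_starProjection_of_mem_of_inner_eq_zero ?_ ?_
  · rw [mem_annihilatedBy]
    intro k hk
    rcases Nat.lt_succ_iff_lt_or_eq.1 hk with h | rfl
    · exact mem_annihilatedBy.1
        (K.sub_mem (K.starProjection_apply_mem _) (K.smul_mem _ huK)) k h
    · rw [inner_sub_right, inner_smul_right, hau, huu]
      rcases eq_or_ne u 0 with h0 | h0
      · simp [h0]
      · have : ‖u‖ ^ 2 ≠ 0 := by simpa using h0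
        field_simp
        ring
  · intro w hw
    have hwK : w ∈ K := annihilatedBy_anti a (Set.Iio_subset_Iio n.le_succ) hw
    have h1 : inner ℝ u w = 0 := by
      rw [← hau, (Submodule.starProjection_eq_self_iff (K := K)).2 hwK]
      exact mem_annihilatedBy.1 hw n (Set.mem_Iio.2 n.lt_succ_self)
    have h2 := Submodule.starProjection_inner_eq_zero (K := K) v w hwK
    rw [show ∀ p q : E, v - (p - q) = (v - p) + q from fun p q => by abel, inner_add_left, h2,
      inner_smul_left, h1]
    simp

/-- A descending chain of subspaces in finite dimension becomes stationary. The index depends on the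
functionals, so passing from finitely many to all of them is a pointwise limit. -/
lemma exists_annihilatedBy_eq_univ (a : ℕ → E) :
    ∃ N, ∀ n, N ≤ n → annihilatedBy a (Set.Iio n) = annihilatedBy a Set.univ := by
  obtain ⟨N, hN⟩ := IsArtinian.monotone_stabilizes
    (R := ℝ) (M := E) ⟨fun n => OrderDual.toDual (annihilatedBy a (Set.Iio n)),
      fun i j hij => annihilatedBy_anti a (Set.Iio_subset_Iio hij)⟩
  have hN' : ∀ n, N ≤ n → annihilatedBy a (Set.Iio N) = annihilatedBy a (Set.Iio n) := hN
  refine ⟨N, fun n hn => le_antisymm (fun v hv => mem_annihilatedBy.2 fun k _ => ?_)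
    (annihilatedBy_anti a (Set.subset_univ _))⟩
  rw [← hN' n hn, hN' (max N (k + 1)) (le_max_left _ _)] at hv
  exact mem_annihilatedBy.1 hv k (Set.mem_Iio.2 (by omega))

variable [MeasurableSpace E] [BorelSpace E]

lemma measurable_starProjection_of_basis {Θ : Type*} [MeasurableSpace Θ] {K : Θ → Submodule ℝ E}
    (h : ∀ v, Measurable fun θ => (K θ).starProjection v) {f : Θ → E} (hf : Measurable f) :
    Measurable fun θ => (K θ).starProjection (f θ) := by
  have : (fun θ => (K θ).starProjection (f θ)) = fun θ => ∑ i,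
      inner ℝ (stdOrthonormalBasis ℝ E i) (f θ) •
        (K θ).starProjection (stdOrthonormalBasis ℝ E i) := by
    ext θ
    conv_lhs => rw [← (stdOrthonormalBasis ℝ E).sum_repr' (f θ)]
    simp
  rw [this]
  refine Finset.measurable_sum _ fun i _ => Measurable.smul ?_ (h _)
  exact measurable_const.inner hf

lemma measurable_starProjection_annihilatedBy_Iio {Θ : Type*} [MeasurableSpace Θ] {a : ℕ → Θ → E}
    (ha : ∀ k, Measurable (a k)) (n : ℕ) (v : E) :
    Measurable fun θ => (annihilatedBy (fun k => a k θ) (Set.Iio n)).starProjection v := by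
  induction n generalizing v with
  | zero => simp only [annihilatedBy_zero, Submodule.starProjection_top]; fun_prop
  | succ n ih =>
    simp only [starProjection_annihilatedBy_succ]
    have hu := measurable_starProjection_of_basis ih (ha n)
    exact (ih v).sub ((((hu.inner measurable_const)).div (hu.norm.pow_const 2)).smul hu)

lemma measurable_starProjection_annihilatedBy {Θ : Type*} [MeasurableSpace Θ] {a : ℕ → Θ → E}
    (ha : ∀ k, Measurable (a k)) (v : E) :
    Measurable fun θ => (annihilatedBy (fun k => a k θ) Set.univ).starProjection v := by
  refine measurable_of_tendsto_metrizable 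
    (fun n => measurable_starProjection_annihilatedBy_Iio ha n v) (tendsto_pi_nhds.2 fun θ => ?_)
  obtain ⟨N, hN⟩ := exists_annihilatedBy_eq_univ fun k => a k θ
  refine tendsto_const_nhds.congr' ?_
  filter_upwards [eventually_ge_atTop N] with n h
  rw [hN n h]

/-- Replacing the component in a subspace by an independent copy preserves the standard Gaussian
measure. -/
lemma map_resample_stdGaussian (K : Submodule ℝ E) :
    ((stdGaussian E).prod (stdGaussian E)).map
      (fun p => p.1 - K.starProjection p.1 + K.starProjection p.2) = stdGaussian E := by
  have hm : Measurable fun p : E × E => p.1 - K.starProjection p.1 + K.starProjection p.2 := by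
    fun_prop
  have := Measure.isProbabilityMeasure_map (μ := (stdGaussian E).prod (stdGaussian E))
    hm.aemeasurable
  refine Measure.ext_of_charFun (funext fun t => ?_)
  -- Self-adjointness moves the projections onto t. The characteristic function then factors over
  -- the two independent copies, and Pythagoras recombines the exponents.
  have h1 : ∀ p : E × E, inner ℝ (p.1 - K.starProjection p.1 + K.starProjection p.2) t =
      inner ℝ p.1 (t - K.starProjection t) + inner ℝ p.2 (K.starProjection t) := fun p => by
    rw [inner_add_left, inner_sub_left, inner_sub_right,
      Submodule.inner_starProjection_left_eq_right, Submodule.inner_starProjection_left_eq_right]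
  rw [charFun_apply, integral_map hm.aemeasurable (by fun_prop)]
  simp only [h1, Complex.ofReal_add, add_mul, Complex.exp_add]
  rw [integral_prod_mul (fun x : E => Complex.exp (↑(inner ℝ x (t - K.starProjection t)) * Complex.I))
    (fun x : E => Complex.exp (↑(inner ℝ x (K.starProjection t)) * Complex.I)),
    ← charFun_apply, ← charFun_apply, charFun_stdGaussian, charFun_stdGaussian,
    charFun_stdGaussian, ← Complex.exp_add]
  congr 1
  have h2 := K.norm_sq_eq_add_norm_sq_starProjection t
  rw [Submodule.starProjection_orthogonal_val] at h2
  have h3 : ((‖t‖ : ℂ)) ^ 2 = (‖K.starProjection t‖ : ℂ) ^ 2 +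
    (‖t - K.starProjection t‖ : ℂ) ^ 2 := by exact_mod_cast h2
  rw [h3]; ring

lemma lintegral_resample_stdGaussian (K : Submodule ℝ E) {g : E → ℝ≥0∞} (hg : Measurable g) :
    ∫⁻ x, ∫⁻ z, g (x - K.starProjection x + K.starProjection z) ∂stdGaussian E ∂stdGaussian E =
      ∫⁻ x, g x ∂stdGaussian E := by
  have hm : Measurable fun p : E × E => p.1 - K.starProjection p.1 + K.starProjection p.2 := by
    fun_prop
  conv_rhs => rw [← map_resample_stdGaussian K, lintegral_map hg hm]
  exact (lintegral_prod _ (hg.comp hm).aemeasurable).symm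

lemma measurable_resample {K : E → Submodule ℝ E}
    (h : ∀ v, Measurable fun x => (K x).starProjection v) :
    Measurable fun p : E × E => p.1 - (K p.1).starProjection p.1 + (K p.1).starProjection p.2 := by
  have h' : ∀ v, Measurable fun p : E × E => (K p.1).starProjection v :=
    fun v => (h v).comp measurable_fst
  exact (measurable_fst.sub (measurable_starProjection_of_basis h' measurable_fst)).add
    (measurable_starProjection_of_basis h' measurable_snd)

/-- The subspace depends on x, so the result for a fixed subspace does not apply directly. But K'
for n + 1 functionals does not change when x is resampled along the larger K for n functionals.
After such a resampling, K' is fixed and `lintegral_resample_stdGaussian` applies. -/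
lemma IsAdaptive.lintegral_resample_Iio {a : ℕ → E → E} (ha : IsAdaptive a)
    (hm : ∀ k, Measurable (a k)) (n : ℕ) {g : E → ℝ≥0∞} (hg : Measurable g) :
    ∫⁻ x, ∫⁻ z, g (x - (annihilatedBy (fun k => a k x) (Set.Iio n)).starProjection x +
        (annihilatedBy (fun k => a k x) (Set.Iio n)).starProjection z)
        ∂stdGaussian E ∂stdGaussian E = ∫⁻ x, g x ∂stdGaussian E := by
  induction n generalizing g with
  | zero => simp only [annihilatedBy_zero, Submodule.starProjection_top, ContinuousLinearMap.id_apply,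
      sub_self, zero_add, lintegral_const, measure_univ, mul_one]
  | succ n ih =>
    have hmeas : Measurable fun p : E × E =>
        g (p.1 - (annihilatedBy (fun k => a k p.1) (Set.Iio (n + 1))).starProjection p.1 +
        (annihilatedBy (fun k => a k p.1) (Set.Iio (n + 1))).starProjection p.2) :=
      hg.comp (measurable_resample
        (K := fun x => annihilatedBy (fun k => a k x) (Set.Iio (n + 1)))
        (measurable_starProjection_annihilatedBy_Iio hm (n + 1)))
    -- The induction hypothesis inserts a resampling along K on both sides, after which they can be
    -- compared for each x separately.
    rw [← ih hmeas.lintegral_prod_right', ← ih hg]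
    refine lintegral_congr fun x => ?_
    set K := annihilatedBy (fun k => a k x) (Set.Iio n) with hK
    set K' := annihilatedBy (fun k => a k x) (Set.Iio (n + 1)) with hK'
    have hle : K' ≤ K := annihilatedBy_anti _ (Set.Iio_subset_Iio n.le_succ)
    have h1 : ∀ v, K'.starProjection (K.starProjection v) = K'.starProjection v := fun v => by
      rw [← ContinuousLinearMap.comp_apply, Submodule.starProjection_comp_starProjection_of_le hle]
    have h2 : ∀ v, K.starProjection (K'.starProjection v) = K'.starProjection v := fun v =>
      Submodule.starProjection_eq_self_iff.2 (hle (Submodule.starProjection_apply_mem _ _))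
    have h3 : Measurable fun v => g (x - K.starProjection x + K.starProjection v) := by
      fun_prop
    rw [← lintegral_resample_stdGaussian K' h3]
    refine lintegral_congr fun z => lintegral_congr fun z' => ?_
    have h4 : annihilatedBy (fun k => a k (x - K.starProjection x + K.starProjection z))
        (Set.Iio (n + 1)) = K' := by
      refine ha.annihilatedBy_Iio_succ_eq n ?_
      rw [show x - K.starProjection x + K.starProjection z - x =
        K.starProjection z - K.starProjection x by abel]
      exact K.sub_mem (Submodule.starProjection_apply_mem _ _)
        (Submodule.starProjection_apply_mem _ _)
    rw [h4]
    congr 1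
    simp only [map_add, map_sub, h1, h2]
    abel

lemma IsAdaptive.lintegral_resample {a : ℕ → E → E} (ha : IsAdaptive a)
    (hm : ∀ k, Measurable (a k)) {g : E → ℝ≥0∞} (hg : Measurable g) :
    ∫⁻ x, ∫⁻ z, g (x - (annihilatedBy (fun k => a k x) Set.univ).starProjection x +
        (annihilatedBy (fun k => a k x) Set.univ).starProjection z)
        ∂stdGaussian E ∂stdGaussian E = ∫⁻ x, g x ∂stdGaussian E := by
  have hM := measurable_resample (K := fun x => annihilatedBy (fun k => a k x) Set.univ)
    (measurable_starProjection_annihilatedBy hm)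
  have hMn := fun n => measurable_resample (K := fun x => annihilatedBy (fun k => a k x) (Set.Iio n))
    (measurable_starProjection_annihilatedBy_Iio hm n)
  have hP := Measure.isProbabilityMeasure_map (μ := (stdGaussian E).prod (stdGaussian E))
    hM.aemeasurable
  have key : ((stdGaussian E).prod (stdGaussian E)).map (fun p : E × E =>
      p.1 - (annihilatedBy (fun k => a k p.1) Set.univ).starProjection p.1 +
        (annihilatedBy (fun k => a k p.1) Set.univ).starProjection p.2) = stdGaussian E := by
    -- Tested against bounded continuous functions, the claim is the limit of the identities for
    -- finitely many functionals: the integrands are eventually constant in n at each point, and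
    -- dominated.
    refine ext_of_forall_lintegral_eq_of_IsFiniteMeasure fun f => ?_
    have hf : Measurable fun x => (f x : ℝ≥0∞) := by
      exact measurable_coe_nnreal_ennreal.comp f.continuous.measurable
    rw [lintegral_map hf hM]
    refine tendsto_nhds_unique (tendsto_lintegral_of_dominated_convergence (fun _ => (nndist f 0 : ℝ≥0∞))
      (fun n => hf.comp (hMn n)) (fun n => ae_of_all _ fun p => ?_) (by simp)
      (ae_of_all _ fun p => ?_)) (tendsto_const_nhds.congr fun n => ?_)
    · exact ENNReal.coe_le_coe.2 (BoundedContinuousFunction.NNReal.upper_bound f _)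
    · obtain ⟨N, hN⟩ := exists_annihilatedBy_eq_univ fun k => a k p.1
      refine tendsto_const_nhds.congr' ?_
      filter_upwards [eventually_ge_atTop N] with n h
      simp only [Function.comp, hN n h]
    · rw [lintegral_prod _ (hf.comp (hMn n)).aemeasurable]
      exact (ha.lintegral_resample_Iio hm n hf).symm
  conv_rhs => rw [← key, lintegral_map hg hM]
  exact (lintegral_prod _ (hg.comp hM).aemeasurable).symm

end AdaptiveGaussian

/-! ### Symmetry arguments for Gaussian means of seminorms -/

section GaussianMean

variable {E : Type*} [NormedAddCommGroup E] [InnerProductSpace ℝ E] [FiniteDimensional ℝ E]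
  [MeasurableSpace E] [BorelSpace E]
  {G : Type*} [NormedAddCommGroup G] [NormedSpace ℝ G]

lemma lintegral_comp_isometry_stdGaussian (R : E ≃ₗᵢ[ℝ] E) {g : E → ℝ≥0∞} (hg : Measurable g) :
    ∫⁻ z, g (R z) ∂stdGaussian E = ∫⁻ z, g z ∂stdGaussian E := by
  conv_rhs => rw [← stdGaussian_map R, lintegral_map hg R.continuous.measurable]

/-- Since z and -z have the same law, it suffices to average over this pair: 2Tz = (b + Tz) - (b -
Tz). -/
lemma lintegral_enorm_le_lintegral_enorm_add (T : E →L[ℝ] G) (b : G) :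
    ∫⁻ z, ‖T z‖ₑ ∂stdGaussian E ≤ ∫⁻ z, ‖b + T z‖ₑ ∂stdGaussian E := by
  have hm : Measurable fun z => ‖b + T z‖ₑ := by
    exact (continuous_const.add T.continuous).enorm.measurable
  have h1 := lintegral_comp_isometry_stdGaussian (LinearIsometryEquiv.neg ℝ (E := E)) hm
  have h2 : ∀ z, 2 * ‖T z‖ₑ ≤ ‖b + T z‖ₑ + ‖b + T (LinearIsometryEquiv.neg ℝ (E := E) z)‖ₑ := by
    intro z
    calc 2 * ‖T z‖ₑ = ‖(b + T z) - (b + T (LinearIsometryEquiv.neg ℝ (E := E) z))‖ₑ := by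
          rw [LinearIsometryEquiv.coe_neg, map_neg, show b + T z - (b + -T z) = (2 : ℝ) • T z by
            rw [two_smul]; abel, enorm_smul]
          congr 1
          simp [enorm_eq_nnnorm]
      _ ≤ _ := enorm_sub_le
  have h3 : 2 * ∫⁻ z, ‖T z‖ₑ ∂stdGaussian E ≤ 2 * ∫⁻ z, ‖b + T z‖ₑ ∂stdGaussian E := by
    rw [← lintegral_const_mul' _ _ (by simp)]
    refine (lintegral_mono h2).trans ?_
    rw [lintegral_add_left hm, h1, two_mul]
  exact (ENNReal.mul_le_mul_iff_right (by simp) (by simp)).1 h3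

/-- The Gaussian mean of the seminorm `‖T ·‖` restricted to a subspace is monotone in the
subspace. -/
lemma lintegral_enorm_starProjection_mono (T : E →L[ℝ] G) {K K' : Submodule ℝ E} (h : K' ≤ K) :
    ∫⁻ z, ‖T (K'.starProjection z)‖ₑ ∂stdGaussian E ≤
      ∫⁻ z, ‖T (K.starProjection z)‖ₑ ∂stdGaussian E := by
  have hm : Measurable fun z => ‖T (K.starProjection z)‖ₑ := by
    exact (T.continuous.comp K.starProjection.continuous).enorm.measurable
  -- The reflection in K' preserves the Gaussian law, and the sum of z and its reflection is twice
  -- the projection of z to K'.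
  have h1 := lintegral_comp_isometry_stdGaussian K'.reflection hm
  have h2 : ∀ z, 2 * ‖T (K'.starProjection z)‖ₑ ≤
      ‖T (K.starProjection z)‖ₑ + ‖T (K.starProjection (K'.reflection z))‖ₑ := by
    intro z
    calc 2 * ‖T (K'.starProjection z)‖ₑ =
          ‖T (K.starProjection z) + T (K.starProjection (K'.reflection z))‖ₑ := by
          have : K.starProjection (K'.starProjection z) = K'.starProjection z :=
            Submodule.starProjection_eq_self_iff.2 (h (K'.starProjection_apply_mem _))
          rw [Submodule.reflection_apply, map_sub, map_nsmul, this, map_sub, add_sub_cancel,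
            map_nsmul, ← Nat.cast_smul_eq_nsmul ℝ, enorm_smul]
          congr 1
          simp [enorm_eq_nnnorm]
      _ ≤ _ := enorm_add_le _ _
  have h3 : 2 * ∫⁻ z, ‖T (K'.starProjection z)‖ₑ ∂stdGaussian E ≤
      2 * ∫⁻ z, ‖T (K.starProjection z)‖ₑ ∂stdGaussian E := by
    rw [← lintegral_const_mul' _ _ (by simp)]
    refine (lintegral_mono h2).trans ?_
    rw [lintegral_add_left hm, h1, two_mul]
  exact (ENNReal.mul_le_mul_iff_right (by simp) (by simp)).1 h3

/-- The average error of adaptive information is at least the average Gaussian mean of `‖T ·‖` over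
the subspaces left undetermined. -/
lemma IsAdaptive.lintegral_le_lintegral_error {a : ℕ → E → E} (ha : IsAdaptive a)
    (hm : ∀ k, Measurable (a k)) (T : E →L[ℝ] G) {out : E → G}
    (hmeas : Measurable fun x => ‖T x - out x‖ₑ)
    (hout : ∀ x w, (∀ k, inner ℝ (a k x) (w - x) = 0) → out w = out x) :
    ∫⁻ x, ∫⁻ z, ‖T ((annihilatedBy (fun k => a k x) Set.univ).starProjection z)‖ₑ
      ∂stdGaussian E ∂stdGaussian E ≤ ∫⁻ x, ‖T x - out x‖ₑ ∂stdGaussian E := by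
  -- After resampling along K the output is unchanged, so for fixed x the error is a centred
  -- Gaussian term shifted by a constant.
  rw [← ha.lintegral_resample hm hmeas]
  refine lintegral_mono fun x => ?_
  set K := annihilatedBy (fun k => a k x) Set.univ with hK
  refine (lintegral_enorm_le_lintegral_enorm_add (T ∘L K.starProjection)
    (T (x - K.starProjection x) - out x)).trans_eq ?_
  refine lintegral_congr fun z => ?_
  have h1 : out (x - K.starProjection x + K.starProjection z) = out x := by
    refine hout _ _ fun k => ?_
    refine (mem_annihilatedBy (s := Set.univ) (a := fun k => a k x)).1 ?_ k trivial
    rw [show x - K.starProjection x + K.starProjection z - x =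
      K.starProjection z - K.starProjection x by abel]
    exact K.sub_mem (K.starProjection_apply_mem _) (K.starProjection_apply_mem _)
  rw [h1, map_add, ContinuousLinearMap.comp_apply]
  congr 1
  abel

end GaussianMean

/-! ### Lewis' theorem by maximizing a determinant -/

section Lewis

open Filter Topology

lemma hasDerivAt_det_one_add_smul {E : Type*} [AddCommGroup E] [Module ℝ E]
    [FiniteDimensional ℝ E] (P : E →ₗ[ℝ] E) :
    HasDerivAt (fun t : ℝ => LinearMap.det (1 + t • P)) (LinearMap.trace ℝ E P) 0 := by
  let b := Module.finBasis ℝ E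
  set M := LinearMap.toMatrix b b P with hM
  set q := (Matrix.det (1 + (Polynomial.X : Polynomial ℝ) • M.map Polynomial.C)).divX.divX
  have h : (fun t : ℝ => LinearMap.det (1 + t • P)) =
      fun t => 1 + LinearMap.trace ℝ E P * t + q.eval t * t ^ 2 := by
    ext t
    rw [← LinearMap.det_toMatrix b, map_add, map_smul, LinearMap.toMatrix_one, ← hM,
      Matrix.det_one_add_smul, LinearMap.trace_eq_matrix_trace ℝ b]
  rw [h]
  have h1 := (((hasDerivAt_id (0 : ℝ)).const_mul (LinearMap.trace ℝ E P)).const_add 1).add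
    ((q.hasDerivAt 0).mul (hasDerivAt_pow 2 (0 : ℝ)))
  exact h1.congr_deriv (by simp)

lemma deriv_nonneg_of_nonneg_right {h : ℝ → ℝ} {h' : ℝ} (hd : HasDerivAt h h' 0) (h0 : h 0 = 0)
    (hn : ∀ t, 0 < t → 0 ≤ h t) : 0 ≤ h' := by
  refine ge_of_tendsto hd.tendsto_slope_zero_right ?_
  filter_upwards [self_mem_nhdsWithin] with t ht
  have ht' : 0 < t := ht
  simp only [zero_add, h0, sub_zero, smul_eq_mul]
  have := hn t ht'
  positivity

variable {E : Type*} [NormedAddCommGroup E] [InnerProductSpace ℝ E] [FiniteDimensional ℝ E]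
  [MeasurableSpace E] [BorelSpace E]
  {G : Type*} [NormedAddCommGroup G] [NormedSpace ℝ G]

lemma integrable_norm_stdGaussian (T : E →L[ℝ] G) :
    Integrable (fun x => ‖T x‖) (stdGaussian E) := by
  refine Integrable.mono' ((IsGaussian.integrable_id (μ := stdGaussian E)).norm.const_mul ‖T‖)
    T.continuous.norm.aestronglyMeasurable (ae_of_all _ fun x => ?_)
  simpa using T.le_opNorm x

lemma lintegral_enorm_stdGaussian (T : E →L[ℝ] G) :
    ∫⁻ x, ‖T x‖ₑ ∂stdGaussian E = ENNReal.ofReal (∫ x, ‖T x‖ ∂stdGaussian E) := by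
  rw [ofReal_integral_eq_lintegral_ofReal (integrable_norm_stdGaussian T)
    (ae_of_all _ fun x => norm_nonneg _)]
  simp

/-- A vanishing mean forces Tx = 0 almost surely. Then L ∘ T has variance 0 for every functional L,
and this variance is determined by the norm of L ∘ T. -/
lemma integral_norm_stdGaussian_pos {T : E →L[ℝ] G} (hT : T ≠ 0) :
    0 < ∫ x, ‖T x‖ ∂stdGaussian E := by
  refine lt_of_le_of_ne (integral_nonneg fun _ => norm_nonneg _) fun h => hT ?_
  have h0 : (fun x => ‖T x‖) =ᵐ[stdGaussian E] 0 :=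
    (integral_eq_zero_iff_of_nonneg (fun _ => norm_nonneg _) (integrable_norm_stdGaussian T)).1 h.symm
  ext v
  by_contra hv
  obtain ⟨L, -, hL⟩ := exists_dual_vector ℝ (T v) (norm_ne_zero_iff.2 hv)
  have h1 : (L ∘L T : StrongDual ℝ E) =ᵐ[stdGaussian E] (0 : E → ℝ) := by
    filter_upwards [h0] with x hx
    have : T x = 0 := by simpa using hx
    simp [this]
  have h2 := variance_dual_stdGaussian (L ∘L T : StrongDual ℝ E)
  rw [variance_congr h1, variance_zero] at h2
  have h3 : (L ∘L T) = 0 := by simpa using h2.symm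
  have h4 : L (T v) = 0 := by rw [← ContinuousLinearMap.comp_apply, h3]; rfl
  rw [hL] at h4
  exact hv (by simpa using h4)

lemma integral_norm_stdGaussian_add_le (T T' : E →L[ℝ] G) :
    ∫ x, ‖(T + T') x‖ ∂stdGaussian E ≤
      ∫ x, ‖T x‖ ∂stdGaussian E + ∫ x, ‖T' x‖ ∂stdGaussian E := by
  rw [← integral_add (integrable_norm_stdGaussian T) (integrable_norm_stdGaussian T')]
  exact integral_mono (integrable_norm_stdGaussian _)
    ((integrable_norm_stdGaussian T).add (integrable_norm_stdGaussian T'))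
    fun x => norm_add_le _ _

lemma continuous_integral_norm_stdGaussian :
    Continuous fun T : E →L[ℝ] G => ∫ x, ‖T x‖ ∂stdGaussian E := by
  refine (LipschitzWith.of_le_add_mul' (∫ x, ‖x‖ ∂stdGaussian E) fun T T' => ?_).continuous
  have h := integral_norm_stdGaussian_add_le T' (T - T')
  rw [add_sub_cancel] at h
  refine h.trans (by
    gcongr
    rw [dist_eq_norm, mul_comm, ← integral_const_mul]
    exact integral_mono (integrable_norm_stdGaussian _)
      ((IsGaussian.integrable_id (μ := stdGaussian E)).norm.const_mul _)
      fun x => (T - T').le_opNorm x)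

/-- **Lewis' theorem** for the Gaussian mean: every injective operator on `E` can be composed with
an automorphism of `E` such that projections reduce the Gaussian mean at most by the ratio of the
dimensions. -/
theorem exists_automorphism_gaussianMean [Nontrivial E] (J : E →L[ℝ] G)
    (hJ : Function.Injective J) :
    ∃ A : E →L[ℝ] E, 0 < ∫ x, ‖J (A x)‖ ∂stdGaussian E ∧ ∀ K : Submodule ℝ E,
      (Module.finrank ℝ K : ℝ) * ∫ x, ‖J (A x)‖ ∂stdGaussian E ≤
        Module.finrank ℝ E * ∫ x, ‖J (A (K.starProjection x))‖ ∂stdGaussian E := by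
  set m := Module.finrank ℝ E with hm
  have hm0 : m ≠ 0 := (Module.finrank_pos (R := ℝ) (M := E)).ne'
  let α : (E →L[ℝ] E) → ℝ := fun B => ∫ x, ‖(J ∘L B) x‖ ∂stdGaussian E
  let δ : (E →L[ℝ] E) → ℝ := fun B => LinearMap.det (B : E →ₗ[ℝ] E)
  have hα0 : ∀ B, 0 ≤ α B := fun B => integral_nonneg fun _ => norm_nonneg _
  have hα : ∀ B, B ≠ 0 → 0 < α B := fun B hB => integral_norm_stdGaussian_pos fun h => hB <| by
    ext v
    exact hJ (by simpa using DFunLike.congr_fun h v)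
  have hαs : ∀ (c : ℝ) B, α (c • B) = |c| * α B := fun c B => by
    simp [α, norm_smul, integral_const_mul]
  have hαa : ∀ B C, α (B + C) ≤ α B + α C := fun B C => by
    have := integral_norm_stdGaussian_add_le (J ∘L B) (J ∘L C)
    rwa [← ContinuousLinearMap.comp_add] at this
  have hαc : Continuous α := continuous_integral_norm_stdGaussian.comp
    (ContinuousLinearMap.compL ℝ E E G J).continuous
  have hδc : Continuous δ := ContinuousLinearMap.continuous_det
  have hδs : ∀ (c : ℝ) B, δ (c • B) = c ^ m * δ B := fun c B => by
    simp [δ, LinearMap.det_smul, hm]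
  have : ProperSpace (E →L[ℝ] E) := FiniteDimensional.proper ℝ _
  -- The quotient |det B| / α(B)^m is invariant under scaling of B, so its maximum on the compact
  -- sphere is a maximum over all B ≠ 0.
  obtain ⟨A, hA, hmax⟩ := (isCompact_sphere (0 : E →L[ℝ] E) 1).exists_isMaxOn
    ⟨1, by simp⟩ (f := fun B => |δ B| / α B ^ m)
    ((hδc.abs.continuousOn).div (hαc.pow m).continuousOn fun B hB =>
      (pow_pos (hα B (by rintro rfl; simp at hB)) m).ne')
  have hA0 : A ≠ 0 := by rintro rfl; simp at hA
  have hαA := hα A hA0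
  have key : ∀ B, |δ B| * α A ^ m ≤ |δ A| * α B ^ m := by
    intro B
    rcases eq_or_ne B 0 with rfl | hB
    · have : δ 0 = 0 := by simpa [hm0] using hδs 0 0
      rw [this]
      have := hα0 0
      simp only [abs_zero, zero_mul]
      positivity
    · have hB' : 0 < ‖B‖ := norm_pos_iff.2 hB
      have h1 : |δ (‖B‖⁻¹ • B)| / α (‖B‖⁻¹ • B) ^ m ≤ |δ A| / α A ^ m :=
        hmax (show ‖B‖⁻¹ • B ∈ Metric.sphere 0 1 by
          simp [norm_smul, hB'.ne'])
      rw [hδs, hαs, mul_pow, abs_mul, abs_pow, mul_div_mul_left _ _ (by positivity),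
        div_le_div_iff₀ (pow_pos (hα B hB) m) (pow_pos hαA m)] at h1
      exact h1
  -- Comparison with the identity: the maximum is positive.
  have hδA : δ A ≠ 0 := by
    intro h
    have h1 := key 1
    rw [h] at h1
    have h2 : δ 1 = 1 := by simp [δ]
    rw [h2] at h1
    have := pow_pos hαA m
    simp only [abs_one, abs_zero, one_mul, zero_mul] at h1
    linarith
  refine ⟨A, hαA, fun K => ?_⟩
  set β := α (A ∘L K.starProjection) with hβ
  change (Module.finrank ℝ K : ℝ) * α A ≤ m * β
  have htr : LinearMap.trace ℝ E (K.starProjection : E →ₗ[ℝ] E) = Module.finrank ℝ K := by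
    refine LinearMap.IsProj.trace ⟨fun x => K.starProjection_apply_mem x, fun x hx => ?_⟩
    exact Submodule.starProjection_eq_self_iff.2 hx
  have hdet := hasDerivAt_det_one_add_smul (K.starProjection : E →ₗ[ℝ] E)
  rw [htr] at hdet
  have hlin : HasDerivAt (fun t : ℝ => α A + t * β) β 0 := by
    simpa using ((hasDerivAt_id (0 : ℝ)).mul_const β).const_add (α A)
  -- First-order condition at A in the direction A ∘ P_K. By maximality and the triangle inequality,
  -- (α(A) + tβ)^m - det(1 + tP_K)·α(A)^m is nonnegative for t > 0. It vanishes at t = 0, and its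
  -- derivative there is m·α(A)^(m-1)·β - dim K·α(A)^m because the trace of P_K is dim K.
  have hd := (hlin.pow m).sub (hdet.mul_const (α A ^ m))
  have hfin := deriv_nonneg_of_nonneg_right hd (by simp) fun t ht => by
    have h1 := key (A + t • (A ∘L K.starProjection))
    have h2 : δ (A + t • (A ∘L K.starProjection)) =
        δ A * LinearMap.det (1 + t • (K.starProjection : E →ₗ[ℝ] E)) := by
      simp only [δ]
      rw [← LinearMap.det_comp]
      congr 1
      ext v
      simp
    rw [h2, abs_mul, mul_assoc] at h1
    have h3 := le_of_mul_le_mul_left h1 (abs_pos.2 hδA)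
    have h4 : α (A + t • (A ∘L K.starProjection)) ≤ α A + t * β := by
      refine (hαa _ _).trans_eq ?_
      rw [hαs, abs_of_pos ht]
    have h5 : α (A + t • (A ∘L K.starProjection)) ^ m ≤ (α A + t * β) ^ m :=
      pow_le_pow_left₀ (hα0 _) h4 m
    have h6 := mul_le_mul_of_nonneg_right
      (le_abs_self (LinearMap.det (1 + t • (K.starProjection : E →ₗ[ℝ] E))))
      (pow_nonneg (hα0 A) m)
    simp only [Pi.sub_apply, Pi.pow_apply]
    linarith
  obtain ⟨k, hk⟩ := Nat.exists_eq_succ_of_ne_zero hm0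
  have h7 : 0 ≤ (α A) ^ k * (m * β - Module.finrank ℝ K * α A) := by
    rw [hk] at hfin ⊢
    simp only [zero_mul, add_zero, Nat.succ_eq_add_one, Nat.add_sub_cancel] at hfin
    calc _ ≤ _ := hfin
      _ = _ := by push_cast; ring
  have h8 := nonneg_of_mul_nonneg_right h7 (pow_pos hαA k)
  linarith

end Lewis

/-! ### Adaptive rules under scaling and along unseen directions -/

section Rules

variable {F : Type u} [NormedAddCommGroup F] [NormedSpace ℝ F]

lemma partialInfo_apply (L : (k : ℕ) → (Fin k → ℝ) → (F →L[ℝ] ℝ)) (f : F) (k : ℕ) (i : Fin k) :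
    partialInfo L f k i = infoSequence L f i := by
  induction k with
  | zero => exact i.elim0
  | succ k ih =>
    refine Fin.lastCases ?_ (fun j => ?_) i
    · simp [partialInfo, infoSequence]
    · simpa [partialInfo] using ih j

lemma partialInfo_zero_right (L : (k : ℕ) → (Fin k → ℝ) → (F →L[ℝ] ℝ)) (k : ℕ) :
    partialInfo L 0 k = 0 := by
  ext i
  rw [partialInfo_apply]
  simp [infoSequence]

lemma partialInfo_congr {L L' : (k : ℕ) → (Fin k → ℝ) → (F →L[ℝ] ℝ)} {n : ℕ}
    (h : ∀ k < n, L k = L' k) (f : F) : partialInfo L f n = partialInfo L' f n := by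
  induction n with
  | zero => rfl
  | succ n ih =>
    simp only [partialInfo]
    rw [ih fun k hk => h k (hk.trans n.lt_succ_self), h n n.lt_succ_self]

lemma partialInfo_smul {L : (k : ℕ) → (Fin k → ℝ) → (F →L[ℝ] ℝ)} {n : ℕ} {f : F} {c : ℝ}
    (h : ∀ k < n, L k (c • partialInfo L f k) = L k (partialInfo L f k)) :
    partialInfo L (c • f) n = c • partialInfo L f n := by
  induction n with
  | zero => ext i; exact i.elim0
  | succ n ih =>
    have ih' := ih fun k hk => h k (hk.trans n.lt_succ_self)
    ext i
    refine Fin.lastCases ?_ (fun j => ?_) i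
    · simp [partialInfo, ih', h n n.lt_succ_self]
    · simpa [partialInfo] using congrFun ih' j

lemma infoSequence_smul {L : (k : ℕ) → (Fin k → ℝ) → (F →L[ℝ] ℝ)} {f : F} {c : ℝ}
    (h : ∀ k, L k (c • partialInfo L f k) = L k (partialInfo L f k)) :
    infoSequence L (c • f) = c • infoSequence L f := by
  ext k
  rw [Pi.smul_apply, infoSequence, infoSequence, partialInfo_smul fun k _ => h k, h, map_smul]

lemma infoCount_smul {L : (k : ℕ) → (Fin k → ℝ) → (F →L[ℝ] ℝ)} {f : F} {c : ℝ}
    (h : ∀ k, L k (c • partialInfo L f k) = L k (partialInfo L f k)) :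
    infoCount L (c • f) = infoCount L f := by
  simp only [infoCount, partialInfo_smul fun k (_ : k < _) => h k, h]

/-- Testing the functionals chosen at f is enough: as long as the values at g agree, the rule
chooses the same functionals there. -/
lemma partialInfo_eq_of_forall {L : (k : ℕ) → (Fin k → ℝ) → (F →L[ℝ] ℝ)} {n : ℕ} {f g : F}
    (h : ∀ k < n, L k (partialInfo L f k) (g - f) = 0) :
    partialInfo L g n = partialInfo L f n := by
  induction n with
  | zero => rfl
  | succ n ih =>
    have h1 := h n n.lt_succ_self
    rw [map_sub, sub_eq_zero] at h1
    simp only [partialInfo]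
    rw [ih fun k hk => h k (hk.trans n.lt_succ_self), h1]

lemma infoSequence_eq_of_forall {L : (k : ℕ) → (Fin k → ℝ) → (F →L[ℝ] ℝ)} {f g : F}
    (h : ∀ k, L k (partialInfo L f k) (g - f) = 0) : infoSequence L g = infoSequence L f := by
  ext k
  have h1 := h k
  rw [map_sub, sub_eq_zero] at h1
  rw [infoSequence, infoSequence, partialInfo_eq_of_forall fun k _ => h k, h1]

/-- Rescaling to the unit sphere. This is how homogeneity of the output enters, and it makes
unbounded random inputs usable. -/
lemma lintegral_error_le_of_homogeneous {Ω : Type w} [MeasurableSpace Ω]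
    {G : Type v} [NormedAddCommGroup G] [NormedSpace ℝ G] {P : Measure Ω} {out : Ω → F → G} {S : F →L[ℝ] G}
    {e : ℝ≥0∞} (hhom : ∀ ω (c : ℝ) f, out ω (c • f) = c • out ω f)
    (he : ∀ f ∈ Metric.closedBall (0 : F) 1, ∫⁻ ω, ‖S f - out ω f‖ₑ ∂P ≤ e) (f : F) :
    ∫⁻ ω, ‖S f - out ω f‖ₑ ∂P ≤ ‖f‖ₑ * e := by
  rcases eq_or_ne f 0 with rfl | hf
  · have : ∀ ω, out ω 0 = 0 := fun ω => by simpa using hhom ω 0 0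
    simp [this]
  · have hf' : ‖f‖ ≠ 0 := norm_ne_zero_iff.2 hf
    have h1 := he (‖f‖⁻¹ • f) (by simp [norm_smul, hf'])
    have h2 : ∀ ω, ‖S f - out ω f‖ₑ =
        ‖f‖ₑ * ‖S (‖f‖⁻¹ • f) - out ω (‖f‖⁻¹ • f)‖ₑ := fun ω => by
      rw [hhom, map_smul, ← smul_sub, enorm_smul, ← mul_assoc, ← enorm_norm f, ← enorm_mul,
        mul_inv_cancel₀ hf', enorm_one, one_mul]
    simp only [h2]
    rw [lintegral_const_mul' _ _ (by simp)]
    gcongr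

end Rules

/-! ### Pulling a rule back to Euclidean space -/

section Pullback

variable {F : Type u} [NormedAddCommGroup F] [NormedSpace ℝ F]
  {E : Type*} [NormedAddCommGroup E] [InnerProductSpace ℝ E] [FiniteDimensional ℝ E]

/-- The vector representing the functional with number `k` chosen at the input `J x`. -/
noncomputable def pulledBackFunctional (L : (k : ℕ) → (Fin k → ℝ) → (F →L[ℝ] ℝ)) (J : E →L[ℝ] F)
    (k : ℕ) (x : E) : E :=
  (InnerProductSpace.toDual ℝ E).symm (L k (partialInfo L (J x) k) ∘L J)

lemma inner_pulledBackFunctional (L : (k : ℕ) → (Fin k → ℝ) → (F →L[ℝ] ℝ)) (J : E →L[ℝ] F)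
    (k : ℕ) (x v : E) :
    inner ℝ (pulledBackFunctional L J k x) v = L k (partialInfo L (J x) k) (J v) := by
  rw [pulledBackFunctional, InnerProductSpace.toDual_symm_apply, ContinuousLinearMap.comp_apply]

lemma isAdaptive_pulledBackFunctional (L : (k : ℕ) → (Fin k → ℝ) → (F →L[ℝ] ℝ)) (J : E →L[ℝ] F) :
    IsAdaptive (pulledBackFunctional L J) := by
  intro k x w h
  rw [pulledBackFunctional, pulledBackFunctional, partialInfo_eq_of_forall (f := J x)]
  intro j hj
  rw [← map_sub, ← inner_pulledBackFunctional]
  exact h j hj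

/-- The subspace of all directions which are not seen by the information at the input `J x`. -/
noncomputable def unseenSubspace (L : (k : ℕ) → (Fin k → ℝ) → (F →L[ℝ] ℝ)) (J : E →L[ℝ] F)
    (x : E) : Submodule ℝ E :=
  annihilatedBy (fun k => pulledBackFunctional L J k x) Set.univ

lemma finrank_le_finrank_unseenSubspace_add (L : (k : ℕ) → (Fin k → ℝ) → (F →L[ℝ] ℝ))
    (J : E →L[ℝ] F) (x : E) {n : ℕ} (h : ∀ k, n ≤ k → L k (partialInfo L (J x) k) = 0) :
    Module.finrank ℝ E ≤ Module.finrank ℝ (unseenSubspace L J x) + n := by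
  classical
  let s : Finset E := (Finset.range n).image fun k => pulledBackFunctional L J k x
  have h1 : Module.finrank ℝ (Submodule.span ℝ (s : Set E)) ≤ n :=
    (finrank_span_finset_le_card s).trans (Finset.card_image_le.trans (Finset.card_range n).le)
  have h2 : (Submodule.span ℝ (s : Set E))ᗮ ≤ unseenSubspace L J x := by
    intro v hv
    refine mem_annihilatedBy.2 fun k _ => ?_
    rcases lt_or_ge k n with hk | hk
    · exact hv _ (Submodule.subset_span (Finset.mem_coe.2
        (Finset.mem_image_of_mem _ (Finset.mem_range.2 hk))))
    · rw [inner_pulledBackFunctional, h k hk, zero_apply]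
  have h3 := Submodule.finrank_mono h2
  have h4 := Submodule.finrank_add_finrank_orthogonal (Submodule.span ℝ (s : Set E))
  omega

lemma finrank_le_finrank_unseenSubspace_add_infoCount
    (L : (k : ℕ) → (Fin k → ℝ) → (F →L[ℝ] ℝ)) (J : E →L[ℝ] F) (x : E) :
    (Module.finrank ℝ E : ℝ≥0∞) ≤
      Module.finrank ℝ (unseenSubspace L J x) + (infoCount L (J x) : ℝ≥0∞) := by
  -- In this form the claim is a lower bound for each n admitted in the infimum defining
  -- `infoCount`. If no n is admitted, the count is infinite and nothing is required.
  have h : ((Module.finrank ℝ E - Module.finrank ℝ (unseenSubspace L J x) : ℕ) : ℕ∞) ≤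
      infoCount L (J x) := by
    refine le_iInf₂ fun n hn => Nat.cast_le.2 ?_
    have := finrank_le_finrank_unseenSubspace_add L J x hn
    omega
  have h' := ENat.toENNReal_le.2 h
  rw [ENat.toENNReal_coe] at h'
  refine le_trans ?_ (add_le_add_right h' _)
  exact_mod_cast (by omega : Module.finrank ℝ E ≤ Module.finrank ℝ (unseenSubspace L J x) +
    (Module.finrank ℝ E - Module.finrank ℝ (unseenSubspace L J x)))

variable [MeasurableSpace E] [BorelSpace E] {Ω : Type w} [MeasurableSpace Ω]

/-- Measurability of the functionals is given only at fixed inputs. Expanding x in an orthonormal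
basis reduces the moving input J x to the finitely many fixed images of basis vectors. -/
lemma measurable_partialInfo_comp {L : Ω → (k : ℕ) → (Fin k → ℝ) → (F →L[ℝ] ℝ)}
    (hL : ∀ k f, Measurable fun p : Ω × (Fin k → ℝ) => L p.1 k p.2 f) (J : E →L[ℝ] F) (k : ℕ) :
    Measurable fun p : Ω × E => partialInfo (L p.1) (J p.2) k := by
  induction k with
  | zero => exact measurable_pi_iff.2 fun i => i.elim0
  | succ k ih =>
    refine measurable_pi_iff.2 fun i => ?_
    refine Fin.lastCases ?_ (fun j => ?_) i
    · have h : ∀ p : Ω × E, L p.1 k (partialInfo (L p.1) (J p.2) k) (J p.2) =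
          ∑ i, inner ℝ (stdOrthonormalBasis ℝ E i) p.2 *
            L p.1 k (partialInfo (L p.1) (J p.2) k) (J (stdOrthonormalBasis ℝ E i)) := fun p => by
        conv_lhs => enter [2]; rw [← (stdOrthonormalBasis ℝ E).sum_repr' p.2]
        simp
      simp only [partialInfo, Fin.snoc_last, h]
      refine Finset.measurable_sum _ fun i _ => Measurable.mul ?_ ?_
      · exact measurable_const.inner measurable_snd
      · exact (hL k _).comp (measurable_fst.prodMk ih)
    · simp only [partialInfo, Fin.snoc_castSucc]
      exact (measurable_pi_apply j).comp ih

lemma measurable_pulledBackFunctional {L : Ω → (k : ℕ) → (Fin k → ℝ) → (F →L[ℝ] ℝ)}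
    (hL : ∀ k f, Measurable fun p : Ω × (Fin k → ℝ) => L p.1 k p.2 f) (J : E →L[ℝ] F) (k : ℕ) :
    Measurable fun p : Ω × E => pulledBackFunctional (L p.1) J k p.2 := by
  have h : ∀ p : Ω × E, pulledBackFunctional (L p.1) J k p.2 =
      ∑ i, L p.1 k (partialInfo (L p.1) (J p.2) k) (J (stdOrthonormalBasis ℝ E i)) •
        stdOrthonormalBasis ℝ E i := fun p => by
    conv_lhs => rw [← (stdOrthonormalBasis ℝ E).sum_repr' (pulledBackFunctional (L p.1) J k p.2)]
    refine Finset.sum_congr rfl fun i _ => ?_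
    rw [real_inner_comm, inner_pulledBackFunctional]
  simp only [h]
  refine Finset.measurable_sum _ fun i _ => Measurable.smul ?_ measurable_const
  exact (hL k _).comp (measurable_fst.prodMk (measurable_partialInfo_comp hL J k))

/-- The dimension is the trace of the orthogonal projection, whose matrix entries are measurable. -/
lemma measurable_finrank_unseenSubspace {L : Ω → (k : ℕ) → (Fin k → ℝ) → (F →L[ℝ] ℝ)}
    (hL : ∀ k f, Measurable fun p : Ω × (Fin k → ℝ) => L p.1 k p.2 f) (J : E →L[ℝ] F) :
    Measurable fun p : Ω × E => (Module.finrank ℝ (unseenSubspace (L p.1) J p.2) : ℝ≥0∞) := by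
  have h : ∀ p : Ω × E, (Module.finrank ℝ (unseenSubspace (L p.1) J p.2) : ℝ≥0∞) =
      ENNReal.ofReal (∑ i, inner ℝ (stdOrthonormalBasis ℝ E i)
        ((unseenSubspace (L p.1) J p.2).starProjection (stdOrthonormalBasis ℝ E i))) := fun p => by
    set K := unseenSubspace (L p.1) J p.2
    have htr : LinearMap.trace ℝ E (K.starProjection : E →ₗ[ℝ] E) = Module.finrank ℝ K :=
      LinearMap.IsProj.trace ⟨fun x => K.starProjection_apply_mem x, fun x hx =>
        Submodule.starProjection_eq_self_iff.2 hx⟩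
    rw [LinearMap.trace_eq_sum_inner _ (stdOrthonormalBasis ℝ E)] at htr
    rw [← ENNReal.ofReal_natCast, ← htr]
    rfl
  simp only [h]
  refine (Finset.measurable_sum _ fun i _ => measurable_const.inner ?_).ennreal_ofReal
  exact measurable_starProjection_annihilatedBy (measurable_pulledBackFunctional hL J) _

variable {G : Type v} [NormedAddCommGroup G] [NormedSpace ℝ G] [MeasurableSpace G] [BorelSpace G]
  [MeasurableSpace F] [BorelSpace F]

/-- The average over a Gaussian input of the expected error of a randomized method, in terms of the
Gaussian means of the unseen subspaces. -/
lemma lintegral_gaussianMean_le_error {P : Measure Ω} [IsProbabilityMeasure P]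
    {L : Ω → (k : ℕ) → (Fin k → ℝ) → (F →L[ℝ] ℝ)}
    (hL : ∀ k f, Measurable fun p : Ω × (Fin k → ℝ) => L p.1 k p.2 f) {out : Ω → F → G}
    (hout : Measurable fun p : Ω × F => out p.1 p.2)
    (hinfo : ∀ ω f g, infoSequence (L ω) g = infoSequence (L ω) f → out ω g = out ω f)
    (S : F →L[ℝ] G) {e : ℝ≥0∞} (he : ∀ f, ∫⁻ ω, ‖S f - out ω f‖ₑ ∂P ≤ ‖f‖ₑ * e)
    (J : E →L[ℝ] F) :
    ∫⁻ ω, ∫⁻ x, ∫⁻ z, ‖S (J ((unseenSubspace (L ω) J x).starProjection z))‖ₑ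
      ∂stdGaussian E ∂stdGaussian E ∂P ≤ (∫⁻ x, ‖J x‖ₑ ∂stdGaussian E) * e := by
  have hJ : Measurable J := J.continuous.measurable
  have hc : Measurable fun p : E × G => ‖S (J p.1) - p.2‖ₑ := by
    have : Continuous fun p : E × G => ‖S (J p.1) - p.2‖ₑ :=
      (((S ∘L J).continuous.comp continuous_fst).sub continuous_snd).enorm
    exact this.measurable
  have hm : Measurable fun p : Ω × E => ‖S (J p.2) - out p.1 (J p.2)‖ₑ :=
    hc.comp (measurable_snd.prodMk
      (hout.comp (measurable_fst.prodMk (hJ.comp measurable_snd))))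
  calc ∫⁻ ω, ∫⁻ x, ∫⁻ z, ‖S (J ((unseenSubspace (L ω) J x).starProjection z))‖ₑ
        ∂stdGaussian E ∂stdGaussian E ∂P
      ≤ ∫⁻ ω, ∫⁻ x, ‖S (J x) - out ω (J x)‖ₑ ∂stdGaussian E ∂P := by
        refine lintegral_mono fun ω => ?_
        refine (isAdaptive_pulledBackFunctional (L ω) J).lintegral_le_lintegral_error
          (fun k => (measurable_pulledBackFunctional hL J k).comp measurable_prodMk_left) (S ∘L J)
          (out := fun x => out ω (J x)) (hm.comp measurable_prodMk_left) fun x w h => ?_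
        refine hinfo _ _ _ (infoSequence_eq_of_forall fun k => ?_)
        rw [← map_sub, ← inner_pulledBackFunctional]
        exact h k
    -- The lower bound holds for fixed ω, the error bound for fixed input; Fubini joins them.
    _ = ∫⁻ x, ∫⁻ ω, ‖S (J x) - out ω (J x)‖ₑ ∂P ∂stdGaussian E :=
        lintegral_lintegral_swap hm.aemeasurable
    _ ≤ ∫⁻ x, ‖J x‖ₑ * e ∂stdGaussian E := lintegral_mono fun x => he (J x)
    _ = _ := lintegral_mul_const _ J.continuous.enorm.measurable

end Pullback

lemma exists_le_finrank_eq {E : Type*} [AddCommGroup E] [Module ℝ E] [FiniteDimensional ℝ E]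
    (K : Submodule ℝ E) {d : ℕ} (hd : d ≤ Module.finrank ℝ K) :
    ∃ K' ≤ K, Module.finrank ℝ K' = d := by
  obtain ⟨f, hf⟩ := exists_linearIndependent_of_le_finrank hd
  refine ⟨(Submodule.span ℝ (Set.range f)).map K.subtype, Submodule.map_subtype_le _ _, ?_⟩
  rw [Submodule.finrank_map_subtype_eq, finrank_span_eq_card hf, Fintype.card_fin]

/-! ### Homogeneous methods on the whole space -/

section Methods

variable {F : Type u} [NormedAddCommGroup F] [NormedSpace ℝ F] [MeasurableSpace F]
  {G : Type v} [MeasurableSpace G] {Ω : Type w} [MeasurableSpace Ω] {P : Measure Ω}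

namespace MonteCarloMethod

variable {n : ℕ} (A : MonteCarloMethod Ω F G n)

/-- The functionals of a method of cardinality `n`, continued by zero. -/
noncomputable def rule (ω : Ω) (k : ℕ) (y : Fin k → ℝ) : F →L[ℝ] ℝ :=
  if k < n then A.functional ω k y else 0

lemma rule_eq_zero (ω : Ω) {k : ℕ} (hk : n ≤ k) : A.rule ω k = 0 := by
  ext y f
  simp [rule, hk.not_gt]

lemma partialInfo_rule (ω : Ω) (f : F) :
    partialInfo (A.rule ω) f n = partialInfo (A.functional ω) f n :=
  partialInfo_congr (fun k hk => by ext y; simp [rule, hk]) f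

lemma measurable_rule (k : ℕ) (f : F) :
    Measurable fun p : Ω × (Fin k → ℝ) => A.rule p.1 k p.2 f := by
  by_cases hk : k < n
  · simpa [rule, hk] using A.measurable_functional k hk f
  · simp [rule, hk]

lemma eval_eq_of_infoSequence_rule_eq (ω : Ω) (f g : F)
    (h : infoSequence (A.rule ω) g = infoSequence (A.rule ω) f) : A.eval ω g = A.eval ω f := by
  have h1 : partialInfo (A.rule ω) g n = partialInfo (A.rule ω) f n := by
    ext i
    rw [partialInfo_apply, partialInfo_apply, h]
  rw [partialInfo_rule, partialInfo_rule] at h1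
  rw [eval, eval, h1]

variable [NormedAddCommGroup G] [NormedSpace ℝ G]

lemma IsHomogeneous.eval_smul {A : MonteCarloMethod Ω F G n} (hA : A.IsHomogeneous) (ω : Ω) (c : ℝ)
    (f : F) : A.eval ω (c • f) = c • A.eval ω f := by
  rcases eq_or_ne c 0 with rfl | hc
  · have := hA.2 ω 0 0
    rw [zero_smul, zero_smul] at this
    rw [zero_smul, zero_smul, eval, partialInfo_zero_right, this]
  · rw [eval, partialInfo_smul fun k hk => hA.1 ω f k hk c hc, hA.2, eval]

lemma IsHomogeneous.lintegral_le {A : MonteCarloMethod Ω F G n} (hA : A.IsHomogeneous)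
    (S : F →L[ℝ] G) (f : F) : ∫⁻ ω, ‖S f - A.eval ω f‖ₑ ∂P ≤ ‖f‖ₑ * A.error P S :=
  lintegral_error_le_of_homogeneous hA.eval_smul
    (fun f hf => le_iSup₂ (f := fun (f : F) (_ : f ∈ Metric.closedBall (0 : F) 1) =>
      ∫⁻ ω, ‖S f - A.eval ω f‖ₑ ∂P) f hf) f

end MonteCarloMethod

namespace VaryingMonteCarloMethod

variable [NormedAddCommGroup G] [NormedSpace ℝ G]

lemma IsHomogeneous.eval_smul {A : VaryingMonteCarloMethod Ω F G} (hA : A.IsHomogeneous) (ω : Ω)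
    (c : ℝ) (f : F) : A.eval ω (c • f) = c • A.eval ω f := by
  rcases eq_or_ne c 0 with rfl | hc
  · have h := hA.2 ω 0 0
    have h0 : infoSequence (A.functional ω) 0 = 0 := by ext k; simp [infoSequence]
    rw [zero_smul, zero_smul] at h
    rw [zero_smul, zero_smul, eval, h0, h]
  · rw [eval, infoSequence_smul fun k => hA.1 ω f k c hc, hA.2, eval]

lemma IsHomogeneous.lintegral_le {A : VaryingMonteCarloMethod Ω F G} (hA : A.IsHomogeneous)
    (S : F →L[ℝ] G) (f : F) : ∫⁻ ω, ‖S f - A.eval ω f‖ₑ ∂P ≤ ‖f‖ₑ * A.error P S :=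
  lintegral_error_le_of_homogeneous hA.eval_smul
    (fun f hf => le_iSup₂ (f := fun (f : F) (_ : f ∈ Metric.closedBall (0 : F) 1) =>
      ∫⁻ ω, ‖S f - A.eval ω f‖ₑ ∂P) f hf) f

/-- Nonzero scaling does not change the cardinality, so the bound on the unit ball holds for all
inputs, in particular for Gaussian ones. -/
lemma IsHomogeneous.lintegral_infoCount_le {A : VaryingMonteCarloMethod Ω F G}
    (hA : A.IsHomogeneous) (f : F) :
    ∫⁻ ω, (infoCount (A.functional ω) f : ℝ≥0∞) ∂P ≤ A.card P := by
  have h : ∀ g ∈ Metric.closedBall (0 : F) 1,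
      ∫⁻ ω, (infoCount (A.functional ω) g : ℝ≥0∞) ∂P ≤ A.card P := fun g hg =>
    le_iSup₂ (f := fun (f : F) (_ : f ∈ Metric.closedBall (0 : F) 1) =>
      ∫⁻ ω, (infoCount (A.functional ω) f : ℝ≥0∞) ∂P) g hg
  rcases eq_or_ne f 0 with rfl | hf
  · exact h 0 (by simp)
  · have hf' : ‖f‖⁻¹ ≠ 0 := inv_ne_zero (norm_ne_zero_iff.2 hf)
    have h1 := h (‖f‖⁻¹ • f) (by simp [norm_smul, norm_ne_zero_iff.2 hf])
    simpa only [infoCount_smul fun k => hA.1 _ f k _ hf'] using h1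

end VaryingMonteCarloMethod

end Methods

/-! ### The lower bounds -/

section LowerBounds

variable {F : Type u} [NormedAddCommGroup F] [NormedSpace ℝ F]
  {G : Type v} [NormedAddCommGroup G] [NormedSpace ℝ G]

lemma iInf_enorm_mul_le (S : F →L[ℝ] G) (X : Submodule ℝ F) {f : F} (hf : f ∈ X) :
    (⨅ (g : F) (_ : g ∈ X) (_ : ‖g‖ = 1), ‖S g‖ₑ) * ‖f‖ₑ ≤ ‖S f‖ₑ := by
  rcases eq_or_ne f 0 with rfl | h0
  · simp
  · have hf' : ‖f‖ ≠ 0 := norm_ne_zero_iff.2 h0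
    have h1 : (⨅ (g : F) (_ : g ∈ X) (_ : ‖g‖ = 1), ‖S g‖ₑ) ≤ ‖S (‖f‖⁻¹ • f)‖ₑ :=
      iInf_le_of_le _ (iInf₂_le (X.smul_mem _ hf) (by simp [norm_smul, hf']))
    refine (mul_le_mul_left h1 _).trans_eq ?_
    rw [map_smul, enorm_smul, mul_right_comm, ← enorm_norm f, ← enorm_mul, inv_mul_cancel₀ hf',
      enorm_one, one_mul]

/-- Every finite dimensional subspace on which `S` is bounded below has a Gaussian parametrization
for which projections reduce the mean of `‖S ·‖` in a controlled way. -/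
lemma exists_gaussian_parametrization (S : F →L[ℝ] G) {m : ℕ} (hm : 1 ≤ m) (X : Submodule ℝ F)
    (hX : Module.rank ℝ X = m) :
    ∃ J : EuclideanSpace ℝ (Fin m) →L[ℝ] F,
      (∫⁻ x, ‖J x‖ₑ ∂stdGaussian (EuclideanSpace ℝ (Fin m))) ≠ 0 ∧
      (∫⁻ x, ‖J x‖ₑ ∂stdGaussian (EuclideanSpace ℝ (Fin m))) ≠ ∞ ∧
      ∀ K : Submodule ℝ (EuclideanSpace ℝ (Fin m)),
        Module.finrank ℝ K * (⨅ (f : F) (_ : f ∈ X) (_ : ‖f‖ = 1), ‖S f‖ₑ) *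
          (∫⁻ x, ‖J x‖ₑ ∂stdGaussian (EuclideanSpace ℝ (Fin m))) ≤
        m * ∫⁻ x, ‖S (J (K.starProjection x))‖ₑ ∂stdGaussian (EuclideanSpace ℝ (Fin m)) := by
  have : Nonempty (Fin m) := ⟨⟨0, hm⟩⟩
  have : Module.Finite ℝ X := Module.finite_of_rank_eq_nat hX
  let i : EuclideanSpace ℝ (Fin m) ≃ₗ[ℝ] X := LinearEquiv.ofFinrankEq _ _ (by
    rw [finrank_euclideanSpace_fin, Module.finrank_eq_of_rank_eq hX])
  let J₀ : EuclideanSpace ℝ (Fin m) →L[ℝ] F :=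
    LinearMap.toContinuousLinearMap (X.subtype ∘ₗ i.toLinearMap)
  have hJ₀X : ∀ x, J₀ x ∈ X := fun x => (i x).2
  obtain ⟨A, hpos, hA⟩ := exists_automorphism_gaussianMean J₀
    (fun x y h => i.injective (Subtype.ext h))
  refine ⟨J₀ ∘L A, ?_, ?_, fun K => ?_⟩
  · rw [lintegral_enorm_stdGaussian]
    simpa using hpos
  · rw [lintegral_enorm_stdGaussian]
    simp
  · set b := (⨅ (f : F) (_ : f ∈ X) (_ : ‖f‖ = 1), ‖S f‖ₑ)
    have h1 := ENNReal.ofReal_le_ofReal (hA K)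
    rw [ENNReal.ofReal_mul (by simp), ENNReal.ofReal_mul (by simp), ENNReal.ofReal_natCast,
      ENNReal.ofReal_natCast, finrank_euclideanSpace_fin] at h1
    have h2 := lintegral_enorm_stdGaussian (J₀ ∘L A)
    have h3 := lintegral_enorm_stdGaussian (J₀ ∘L A ∘L K.starProjection)
    simp only [ContinuousLinearMap.comp_apply] at h2 h3 ⊢
    rw [← h2, ← h3] at h1
    have hmeas : Measurable fun x => ‖J₀ (A (K.starProjection x))‖ₑ :=
      (J₀ ∘L A ∘L K.starProjection).continuous.enorm.measurable
    calc _ = b * (Module.finrank ℝ K *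
          ∫⁻ x, ‖J₀ (A x)‖ₑ ∂stdGaussian (EuclideanSpace ℝ (Fin m))) := by ring
      _ ≤ b * (m * ∫⁻ x, ‖J₀ (A (K.starProjection x))‖ₑ
          ∂stdGaussian (EuclideanSpace ℝ (Fin m))) := by gcongr
      _ = m * ∫⁻ x, b * ‖J₀ (A (K.starProjection x))‖ₑ
          ∂stdGaussian (EuclideanSpace ℝ (Fin m)) := by
        rw [lintegral_const_mul _ hmeas]; ring
      _ ≤ _ := by
        gcongr
        exact iInf_enorm_mul_le S X (hJ₀X _)

lemma ofReal_sub_div_mul_le {m : ℕ} (hm : 1 ≤ m) {q : ℝ} (hq : 0 ≤ q) {d b e : ℝ≥0∞}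
    (h1 : (m : ℝ≥0∞) ≤ d + ENNReal.ofReal q) (h2 : d * b ≤ m * e) :
    ENNReal.ofReal ((m - q) / m) * b ≤ e := by
  have hm' : (0 : ℝ) < m := by exact_mod_cast hm
  rw [ENNReal.ofReal_div_of_pos hm', ENNReal.ofReal_sub _ hq, ENNReal.ofReal_natCast,
    ENNReal.div_eq_inv_mul, mul_assoc]
  calc (m : ℝ≥0∞)⁻¹ * ((m - ENNReal.ofReal q) * b) ≤ (m : ℝ≥0∞)⁻¹ * (m * e) := by
        exact mul_le_mul_right ((mul_le_mul_left (tsub_le_iff_right.2 h1) _).trans h2) _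
    _ = e := by
        rw [← mul_assoc, ENNReal.inv_mul_cancel (by positivity) (by simp), one_mul]

variable [MeasurableSpace F] [BorelSpace F] [MeasurableSpace G] [BorelSpace G]
  {Ω : Type w} [MeasurableSpace Ω] {P : Measure Ω} [IsProbabilityMeasure P]

/-- The hypothesis on J is linear in the dimension of K, so it can be integrated over ω and x with K
the unseen subspace. The Gaussian mean of J then cancels. -/
lemma lintegral_finrank_unseenSubspace_mul_le {E : Type*} [NormedAddCommGroup E]
    [InnerProductSpace ℝ E] [FiniteDimensional ℝ E] [MeasurableSpace E] [BorelSpace E]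
    {L : Ω → (k : ℕ) → (Fin k → ℝ) → (F →L[ℝ] ℝ)}
    (hL : ∀ k f, Measurable fun p : Ω × (Fin k → ℝ) => L p.1 k p.2 f) {out : Ω → F → G}
    (hout : Measurable fun p : Ω × F => out p.1 p.2)
    (hinfo : ∀ ω f g, infoSequence (L ω) g = infoSequence (L ω) f → out ω g = out ω f)
    (S : F →L[ℝ] G) {e : ℝ≥0∞} (he : ∀ f, ∫⁻ ω, ‖S f - out ω f‖ₑ ∂P ≤ ‖f‖ₑ * e)
    (J : E →L[ℝ] F) (h0 : ∫⁻ x, ‖J x‖ₑ ∂stdGaussian E ≠ 0)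
    (htop : ∫⁻ x, ‖J x‖ₑ ∂stdGaussian E ≠ ∞) {b : ℝ≥0∞} {m : ℕ}
    (hJ : ∀ K : Submodule ℝ E, Module.finrank ℝ K * b * (∫⁻ x, ‖J x‖ₑ ∂stdGaussian E) ≤
      m * ∫⁻ x, ‖S (J (K.starProjection x))‖ₑ ∂stdGaussian E) :
    (∫⁻ ω, ∫⁻ x, Module.finrank ℝ (unseenSubspace (L ω) J x) ∂stdGaussian E ∂P) * b ≤ m * e := by
  have main := lintegral_gaussianMean_le_error hL hout hinfo S he J
  generalize ∫⁻ x, ‖J x‖ₑ ∂stdGaussian E = α at h0 htop hJ main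
  have hd := measurable_finrank_unseenSubspace hL J
  have hω : ∀ ω, Measurable fun x => (Module.finrank ℝ (unseenSubspace (L ω) J x) : ℝ≥0∞) :=
    fun ω => by
      have h := hd.comp (measurable_prodMk_left (x := ω))
      simpa only [Function.comp_def] using h
  have hd' : Measurable fun ω => ∫⁻ x, (Module.finrank ℝ (unseenSubspace (L ω) J x) : ℝ≥0∞)
    ∂stdGaussian E := by
    simpa using hd.lintegral_prod_right' (ν := stdGaussian E)
  refine (ENNReal.mul_le_mul_iff_left h0 htop).1 ?_
  calc (∫⁻ ω, ∫⁻ x, Module.finrank ℝ (unseenSubspace (L ω) J x) ∂stdGaussian E ∂P) * b * α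
      = ∫⁻ ω, ∫⁻ x, Module.finrank ℝ (unseenSubspace (L ω) J x) * b * α ∂stdGaussian E ∂P := by
        simp_rw [mul_assoc, lintegral_mul_const _ (hω _)]
        rw [lintegral_mul_const _ hd']
    _ ≤ ∫⁻ ω, ∫⁻ x, m * ∫⁻ z, ‖S (J ((unseenSubspace (L ω) J x).starProjection z))‖ₑ
        ∂stdGaussian E ∂stdGaussian E ∂P :=
        lintegral_mono fun ω => lintegral_mono fun x => hJ _
    _ = m * ∫⁻ ω, ∫⁻ x, ∫⁻ z, ‖S (J ((unseenSubspace (L ω) J x).starProjection z))‖ₑ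
        ∂stdGaussian E ∂stdGaussian E ∂P := by
        simp_rw [lintegral_const_mul' _ _ (ENNReal.natCast_ne_top m)]
    _ ≤ m * (α * e) := by gcongr
    _ = m * e * α := by ring

/-- Common core of both Bernstein bounds: q bounds the average number of dimensions lost to the
information. -/
lemma ofReal_mul_bernsteinNumber_le {L : Ω → (k : ℕ) → (Fin k → ℝ) → (F →L[ℝ] ℝ)}
    (hL : ∀ k f, Measurable fun p : Ω × (Fin k → ℝ) => L p.1 k p.2 f) {out : Ω → F → G}
    (hout : Measurable fun p : Ω × F => out p.1 p.2)
    (hinfo : ∀ ω f g, infoSequence (L ω) g = infoSequence (L ω) f → out ω g = out ω f)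
    (S : F →L[ℝ] G) {e : ℝ≥0∞} (he : ∀ f, ∫⁻ ω, ‖S f - out ω f‖ₑ ∂P ≤ ‖f‖ₑ * e)
    {m : ℕ} (hm : 1 ≤ m) {q : ℝ} (hq : 0 ≤ q)
    (hcount : ∀ J : EuclideanSpace ℝ (Fin m) →L[ℝ] F, (m : ℝ≥0∞) ≤
      ∫⁻ ω, ∫⁻ x, Module.finrank ℝ (unseenSubspace (L ω) J x)
        ∂stdGaussian (EuclideanSpace ℝ (Fin m)) ∂P + ENNReal.ofReal q) :
    ENNReal.ofReal ((m - q) / m) * bernsteinNumber S m ≤ e := by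
  simp only [bernsteinNumber, ENNReal.mul_iSup]
  refine iSup₂_le fun X hX => ?_
  obtain ⟨J, h0, htop, hJ⟩ := exists_gaussian_parametrization S hm X hX
  exact ofReal_sub_div_mul_le hm hq (hcount J)
    (lintegral_finrank_unseenSubspace_mul_le hL hout hinfo S he J h0 htop hJ)

lemma iInf_gaussianMean_div_le {L : Ω → (k : ℕ) → (Fin k → ℝ) → (F →L[ℝ] ℝ)}
    (hL : ∀ k f, Measurable fun p : Ω × (Fin k → ℝ) => L p.1 k p.2 f) {out : Ω → F → G}
    (hout : Measurable fun p : Ω × F => out p.1 p.2)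
    (hinfo : ∀ ω f g, infoSequence (L ω) g = infoSequence (L ω) f → out ω g = out ω f)
    (S : F →L[ℝ] G) {e : ℝ≥0∞} (he : ∀ f, ∫⁻ ω, ‖S f - out ω f‖ₑ ∂P ≤ ‖f‖ₑ * e)
    {m n : ℕ} (hn : ∀ ω k, n ≤ k → L ω k = 0) (J : EuclideanSpace ℝ (Fin m) →L[ℝ] F)
    (hJ : Function.Injective J) :
    (⨅ (K : Submodule ℝ (EuclideanSpace ℝ (Fin m))) (_ : Module.finrank ℝ K = m - n),
        (∫⁻ x, ‖S (J (K.starProjection x))‖ₑ ∂(stdGaussian (EuclideanSpace ℝ (Fin m)))) /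
          (∫⁻ x, ‖J x‖ₑ ∂(stdGaussian (EuclideanSpace ℝ (Fin m))))) ≤ e := by
  set c := (⨅ (K : Submodule ℝ (EuclideanSpace ℝ (Fin m))) (_ : Module.finrank ℝ K = m - n),
        (∫⁻ x, ‖S (J (K.starProjection x))‖ₑ ∂(stdGaussian (EuclideanSpace ℝ (Fin m)))) /
          (∫⁻ x, ‖J x‖ₑ ∂(stdGaussian (EuclideanSpace ℝ (Fin m))))) with hc
  have main := lintegral_gaussianMean_le_error hL hout hinfo S he J
  set α := ∫⁻ x, ‖J x‖ₑ ∂(stdGaussian (EuclideanSpace ℝ (Fin m))) with hα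
  rcases Nat.eq_zero_or_pos m with rfl | hm
  -- For m = 0 the quotient is 0/0, which is 0 in `ℝ≥0∞`.
  · refine (iInf₂_le (⊥ : Submodule ℝ (EuclideanSpace ℝ (Fin 0))) (by simp)).trans ?_
    simp
  · have : Nonempty (Fin m) := ⟨⟨0, hm⟩⟩
    have hJ0 : J ≠ 0 := by
      rintro rfl
      obtain ⟨x, hx⟩ := exists_ne (0 : EuclideanSpace ℝ (Fin m))
      exact hx (hJ rfl)
    have h0 : α ≠ 0 := by
      rw [hα, lintegral_enorm_stdGaussian]
      simpa using integral_norm_stdGaussian_pos hJ0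
    have htop : α ≠ ∞ := by
      rw [hα, lintegral_enorm_stdGaussian]
      simp
    refine (ENNReal.mul_le_mul_iff_right h0 htop).1 (le_trans ?_ main)
    have h1 : ∀ ω x, α * c ≤ ∫⁻ z, ‖S (J ((unseenSubspace (L ω) J x).starProjection z))‖ₑ
        ∂stdGaussian (EuclideanSpace ℝ (Fin m)) := by
      intro ω x
      have h2 := finrank_le_finrank_unseenSubspace_add (L ω) J x (n := n) fun k hk => by
        rw [hn ω k hk]; rfl
      rw [finrank_euclideanSpace_fin] at h2
      -- The unseen subspace may exceed dimension m - n; a subspace of exactly this dimension has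
      -- the smaller Gaussian mean.
      obtain ⟨K', hle, hK'⟩ := exists_le_finrank_eq (unseenSubspace (L ω) J x)
        (Nat.sub_le_iff_le_add.2 h2)
      refine le_trans ?_ (lintegral_enorm_starProjection_mono (S ∘L J) hle)
      have h3 : c ≤ _ := iInf₂_le K' hK'
      rw [mul_comm]
      exact (ENNReal.le_div_iff_mul_le (.inl h0) (.inl htop)).1 h3
    calc α * c = ∫⁻ _ω, ∫⁻ _x, α * c ∂stdGaussian (EuclideanSpace ℝ (Fin m)) ∂P := by simp
      _ ≤ _ := lintegral_mono fun ω => lintegral_mono fun x => h1 ω x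

theorem ofReal_mul_bernsteinNumber_le_homMonteCarloError (S : F →L[ℝ] G) {n m : ℕ} (hnm : n < m) :
    ENNReal.ofReal (((m : ℝ) - n) / m) * bernsteinNumber S m ≤
      homMonteCarloError.{u, v, w} n S := by
  refine le_iInf fun Ω => le_iInf fun _ => le_iInf fun P => le_iInf fun _ => le_iInf fun A =>
    le_iInf fun hA => ?_
  refine ofReal_mul_bernsteinNumber_le A.measurable_rule (out := A.eval) A.measurable_output
    A.eval_eq_of_infoSequence_rule_eq S (hA.lintegral_le S) (by omega) (by positivity) fun J => ?_
  calc (m : ℝ≥0∞) = ∫⁻ _ω, ∫⁻ _x, ((m - n : ℕ) : ℝ≥0∞)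
        ∂stdGaussian (EuclideanSpace ℝ (Fin m)) ∂P + ENNReal.ofReal n := by
        simp only [lintegral_const, measure_univ, mul_one, ENNReal.ofReal_natCast]
        exact_mod_cast (by omega : m = m - n + n)
    _ ≤ _ := by
        gcongr with ω x
        have h2 := finrank_le_finrank_unseenSubspace_add (A.rule ω) J x (n := n) fun k hk => by
          rw [A.rule_eq_zero ω hk]; rfl
        rw [finrank_euclideanSpace_fin] at h2
        omega

theorem iInf_gaussianMean_div_le_homMonteCarloError (S : F →L[ℝ] G) (n : ℕ) {m : ℕ}
    (J : EuclideanSpace ℝ (Fin m) →ₗ[ℝ] F) (hJ : Function.Injective J) :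
    (⨅ (K : Submodule ℝ (EuclideanSpace ℝ (Fin m))) (_ : Module.finrank ℝ K = m - n),
        (∫⁻ x, ‖S (J (K.starProjection x))‖ₑ ∂(stdGaussian (EuclideanSpace ℝ (Fin m)))) /
          (∫⁻ x, ‖J x‖ₑ ∂(stdGaussian (EuclideanSpace ℝ (Fin m))))) ≤
      homMonteCarloError.{u, v, w} n S := by
  refine le_iInf fun Ω => le_iInf fun _ => le_iInf fun P => le_iInf fun _ => le_iInf fun A =>
    le_iInf fun hA => ?_
  exact iInf_gaussianMean_div_le A.measurable_rule (out := A.eval) A.measurable_output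
    A.eval_eq_of_infoSequence_rule_eq S (hA.lintegral_le (P := P) S) (fun ω k => A.rule_eq_zero ω)
    (LinearMap.toContinuousLinearMap J) hJ

theorem ofReal_mul_bernsteinNumber_le_homMonteCarloErrorVarying (S : F →L[ℝ] G) (nbar : ℝ≥0)
    {m : ℕ} (hm : 1 ≤ m) :
    ENNReal.ofReal (max (((m : ℝ) - nbar) / m) 0) * bernsteinNumber S m ≤
      homMonteCarloErrorVarying.{u, v, w} nbar S := by
  refine le_iInf fun Ω => le_iInf fun _ => le_iInf fun P => le_iInf fun _ => le_iInf fun A =>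
    le_iInf fun hA => le_iInf fun hcard => ?_
  rw [ENNReal.ofReal_max, ENNReal.ofReal_zero, max_eq_left zero_le]
  refine ofReal_mul_bernsteinNumber_le A.measurable_functional
    (out := A.eval) A.measurable_output
    (fun ω f g h => by rw [VaryingMonteCarloMethod.eval, VaryingMonteCarloMethod.eval, h]) S
    (hA.lintegral_le S) hm nbar.coe_nonneg fun J => ?_
  have hd := measurable_finrank_unseenSubspace A.measurable_functional J
  have hsub : ∀ ω x, (m : ℝ≥0∞) - Module.finrank ℝ (unseenSubspace (A.functional ω) J x) ≤
      (infoCount (A.functional ω) (J x) : ℝ≥0∞) := fun ω x => by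
    have := finrank_le_finrank_unseenSubspace_add_infoCount (A.functional ω) J x
    rw [finrank_euclideanSpace_fin] at this
    exact tsub_le_iff_left.2 this
  -- The codimension is measurable, so the integrals may be exchanged. For fixed x it is then
  -- dominated by `infoCount`, whose mean over ω is at most nbar; this needs only monotonicity of
  -- the integral.
  have hcodim : ∫⁻ ω, ∫⁻ x, ((m : ℝ≥0∞) - Module.finrank ℝ (unseenSubspace (A.functional ω) J x))
      ∂stdGaussian (EuclideanSpace ℝ (Fin m)) ∂P ≤ ENNReal.ofReal nbar := by
    rw [lintegral_lintegral_swap (Measurable.aemeasurable (measurable_const.sub hd))]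
    calc _ ≤ ∫⁻ _x, (nbar : ℝ≥0∞) ∂stdGaussian (EuclideanSpace ℝ (Fin m)) :=
          lintegral_mono fun x => (lintegral_mono fun ω => hsub ω x).trans
            ((hA.lintegral_infoCount_le _).trans hcard)
      _ = _ := by simp
  calc (m : ℝ≥0∞) = ∫⁻ _ω, ∫⁻ _x, (m : ℝ≥0∞) ∂stdGaussian (EuclideanSpace ℝ (Fin m)) ∂P := by simp
    _ ≤ ∫⁻ ω, ∫⁻ x, (Module.finrank ℝ (unseenSubspace (A.functional ω) J x) +
          ((m : ℝ≥0∞) - Module.finrank ℝ (unseenSubspace (A.functional ω) J x)))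
          ∂stdGaussian (EuclideanSpace ℝ (Fin m)) ∂P :=
        lintegral_mono fun ω => lintegral_mono fun x => le_add_tsub
    _ = ∫⁻ ω, ∫⁻ x, Module.finrank ℝ (unseenSubspace (A.functional ω) J x)
          ∂stdGaussian (EuclideanSpace ℝ (Fin m)) ∂P +
        ∫⁻ ω, ∫⁻ x, ((m : ℝ≥0∞) - Module.finrank ℝ (unseenSubspace (A.functional ω) J x))
          ∂stdGaussian (EuclideanSpace ℝ (Fin m)) ∂P := by
        rw [← lintegral_add_left hd.lintegral_prod_right']
        refine lintegral_congr fun ω => ?_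
        exact lintegral_add_left (hd.comp measurable_prodMk_left) _
    _ ≤ _ := by gcongr

end LowerBounds

/-! ### Optimal methods for the identity of ℓ_1^m -/

section Sharpness

lemma bernsteinNumber_id_of_rank_eq {F : Type u} [NormedAddCommGroup F] [NormedSpace ℝ F] {m : ℕ}
    (hm : 1 ≤ m) (hF : Module.rank ℝ F = m) :
    bernsteinNumber (ContinuousLinearMap.id ℝ F) m = 1 := by
  refine le_antisymm (iSup₂_le fun X hX => ?_) ?_
  · have : Nontrivial X := by
      have h0 : 0 < Module.rank ℝ X := by rw [hX]; exact_mod_cast hm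
      exact rank_pos_iff_nontrivial.1 h0
    obtain ⟨x, hx⟩ := exists_norm_eq X zero_le_one
    have hx' : ‖(x : F)‖ = 1 := hx
    refine iInf_le_of_le (x : F) (iInf₂_le_of_le x.2 hx' ?_)
    rw [ContinuousLinearMap.id_apply, ← enorm_norm, hx', enorm_one]
  · refine le_iSup₂_of_le ⊤ (by rw [rank_top, hF]) (le_iInf fun f => le_iInf₂ fun _ hf => ?_)
    rw [ContinuousLinearMap.id_apply, ← enorm_norm, hf, enorm_one]

lemma PiLp.enorm_eq_sum {m : ℕ} (f : PiLp 1 fun _ : Fin m => ℝ) : ‖f‖ₑ = ∑ i, ‖f i‖ₑ := by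
  simp only [enorm_eq_nnnorm, PiLp.nnnorm_eq_of_L1]
  push_cast
  rfl

variable {Ω : Type w} [MeasurableSpace Ω]

lemma homMonteCarloError_le {F : Type u} [NormedAddCommGroup F] [NormedSpace ℝ F]
    [MeasurableSpace F] {G : Type v} [NormedAddCommGroup G] [NormedSpace ℝ G] [MeasurableSpace G]
    {n : ℕ} {A : MonteCarloMethod Ω F G n} (hA : A.IsHomogeneous) (P : Measure Ω)
    [IsProbabilityMeasure P] (S : F →L[ℝ] G) : homMonteCarloError.{u, v, w} n S ≤ A.error P S :=
  iInf_le_of_le Ω <| iInf_le_of_le _ <| iInf_le_of_le P <| iInf_le_of_le ‹_› <|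
    iInf_le_of_le A <| iInf_le_of_le hA le_rfl

lemma homMonteCarloErrorVarying_le {F : Type u} [NormedAddCommGroup F] [NormedSpace ℝ F]
    [MeasurableSpace F] {G : Type v} [NormedAddCommGroup G] [NormedSpace ℝ G] [MeasurableSpace G]
    {A : VaryingMonteCarloMethod Ω F G} (hA : A.IsHomogeneous) (P : Measure Ω)
    [IsProbabilityMeasure P] {nbar : ℝ≥0} (hcard : A.card P ≤ nbar) (S : F →L[ℝ] G) :
    homMonteCarloErrorVarying.{u, v, w} nbar S ≤ A.error P S :=
  iInf_le_of_le Ω <| iInf_le_of_le _ <| iInf_le_of_le P <| iInf_le_of_le ‹_› <|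
    iInf_le_of_le A <| iInf_le_of_le hA <| iInf_le_of_le hcard le_rfl

variable [Countable Ω] [MeasurableSingletonClass Ω] {m : ℕ}

/-- The method on `ℓ_1^m` which evaluates the coordinates `idx ω 0, …, idx ω (n - 1)` and sets the
other ones to zero. The value of the coordinate `i` is looked up at the position `pos ω i`. -/
noncomputable def coordinateMethod (n : ℕ) (idx : Ω → ℕ → Fin m) (pos : Ω → Fin m → ℕ) :
    MonteCarloMethod Ω (PiLp 1 fun _ : Fin m => ℝ) (PiLp 1 fun _ : Fin m => ℝ) n where
  functional ω k _ := PiLp.proj 1 (fun _ => ℝ) (idx ω k)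
  output ω y := WithLp.toLp 1 fun i => if h : pos ω i < n then y ⟨pos ω i, h⟩ else 0
  measurable_functional k _ f := by
    refine measurable_from_prod_countable_right fun ω => ?_
    simp only [measurable_const]
  measurable_info := by
    refine measurable_from_prod_countable_right fun ω => measurable_pi_iff.2 fun i => ?_
    simp only [partialInfo_apply]
    exact (PiLp.proj 1 (fun _ => ℝ) (idx ω i)).continuous.measurable
  measurable_output := by
    refine measurable_from_prod_countable_right fun ω => Continuous.measurable ?_
    refine (PiLp.continuous_toLp 1 _).comp (continuous_pi fun i => ?_)
    by_cases h : pos ω i < n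
    · simp only [h, dite_true, partialInfo_apply]
      exact (PiLp.proj 1 (fun _ => ℝ) (idx ω (pos ω i))).continuous
    · simp only [h, dite_false]
      exact continuous_const

lemma coordinateMethod_isHomogeneous (n : ℕ) (idx : Ω → ℕ → Fin m) (pos : Ω → Fin m → ℕ) :
    (coordinateMethod n idx pos).IsHomogeneous := by
  refine ⟨fun _ _ _ _ _ _ => rfl, fun ω f c => ?_⟩
  ext i
  by_cases h : pos ω i < n <;> simp [coordinateMethod, h]

lemma coordinateMethod_eval_apply (n : ℕ) {idx : Ω → ℕ → Fin m} {pos : Ω → Fin m → ℕ}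
    (h : ∀ ω i, idx ω (pos ω i) = i) (ω : Ω) (f : PiLp 1 fun _ : Fin m => ℝ) (i : Fin m) :
    (coordinateMethod n idx pos).eval ω f i = if pos ω i < n then f i else 0 := by
  by_cases hi : pos ω i < n
  · simp only [MonteCarloMethod.eval, coordinateMethod, hi, dite_true, if_true, partialInfo_apply,
      infoSequence]
    rw [PiLp.proj_apply, h]
  · simp [MonteCarloMethod.eval, coordinateMethod, hi]

/-- Coordinates are read cyclically from a uniformly random start, so each is missed with
probability (m - n)₊/m. The ℓ_1 error is the sum of the missed |f i|, and its mean is this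
probability times ‖f‖. -/
lemma homMonteCarloError_id_le (hm : 1 ≤ m) (n : ℕ) :
    homMonteCarloError.{0, 0, w} n (ContinuousLinearMap.id ℝ (PiLp 1 fun _ : Fin m => ℝ)) ≤
      ENNReal.ofReal (max (((m : ℝ) - n) / m) 0) := by
  have : NeZero m := ⟨by omega⟩
  have hm0 : (m : ℝ≥0∞) ≠ 0 := by simp; omega
  let P : Measure (ULift.{w} (Fin m)) := (m : ℝ≥0∞)⁻¹ • Measure.count
  have hP : ∀ g : ULift.{w} (Fin m) → ℝ≥0∞, ∫⁻ ω, g ω ∂P = (m : ℝ≥0∞)⁻¹ * ∑ j, g ⟨j⟩ := fun g => by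
    rw [lintegral_smul_measure, lintegral_count, tsum_fintype, smul_eq_mul]
    congr 1
    exact Equiv.ulift.sum_comp fun j => g ⟨j⟩
  have : IsProbabilityMeasure P := ⟨by
    rw [← lintegral_one, hP]
    simp [ENNReal.inv_mul_cancel hm0]⟩
  let idx : ULift.{w} (Fin m) → ℕ → Fin m := fun ω k => ω.down + Fin.ofNat m k
  let pos : ULift.{w} (Fin m) → Fin m → ℕ := fun ω i => (i - ω.down).val
  have hpos : ∀ ω i, idx ω (pos ω i) = i := fun ω i => by
    simp [idx, pos]
  refine (homMonteCarloError_le (coordinateMethod_isHomogeneous n idx pos) P _).trans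
    (iSup₂_le fun f hf => ?_)
  have hf' : ‖f‖ₑ ≤ 1 := by
    rw [mem_closedBall_zero_iff] at hf
    rwa [← ofReal_norm, ENNReal.ofReal_le_one]
  -- For fixed i, the map j ↦ i - j permutes `Fin m`, so exactly the residues from n to m - 1 are
  -- counted.
  have hcount : ∀ i : Fin m, ∑ j : Fin m, (if (i - j).val < n then (0 : ℝ≥0∞) else 1) =
      ((m - n : ℕ) : ℝ≥0∞) := fun i => by
    have h0 := (Equiv.subLeft i).sum_comp fun j : Fin m => if j.val < n then (0 : ℝ≥0∞) else 1
    simp only [Equiv.subLeft_apply] at h0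
    rw [h0, Fin.sum_univ_eq_sum_range fun j => if j < n then (0 : ℝ≥0∞) else 1]
    have h1 : (Finset.range m).filter (fun j => ¬ j < n) = Finset.Ico n m := by
      ext j; simp; omega
    rw [Finset.sum_ite, Finset.sum_const_zero, zero_add, Finset.sum_const, h1, Nat.card_Ico,
      nsmul_one]
  calc ∫⁻ ω, ‖ContinuousLinearMap.id ℝ (PiLp 1 fun _ : Fin m => ℝ) f -
        (coordinateMethod n idx pos).eval ω f‖ₑ ∂P
      = (m : ℝ≥0∞)⁻¹ * ∑ j : Fin m, ∑ i, (if (i - j).val < n then 0 else 1) * ‖f i‖ₑ := by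
        rw [hP]
        congr 1
        refine Finset.sum_congr rfl fun j _ => ?_
        rw [PiLp.enorm_eq_sum]
        refine Finset.sum_congr rfl fun i _ => ?_
        rw [PiLp.sub_apply, coordinateMethod_eval_apply n hpos]
        by_cases h : (i - j).val < n <;> simp [pos, h]
    _ = (m : ℝ≥0∞)⁻¹ * ((m - n : ℕ) * ‖f‖ₑ) := by
        rw [Finset.sum_comm, PiLp.enorm_eq_sum]
        simp_rw [← Finset.sum_mul, hcount, ← Finset.mul_sum]
    _ ≤ (m : ℝ≥0∞)⁻¹ * ((m - n : ℕ) * 1) := by gcongr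
    _ = ENNReal.ofReal (max (((m : ℝ) - n) / m) 0) := by
        rw [mul_one, ENNReal.ofReal_max, ENNReal.ofReal_zero, max_eq_left zero_le,
          ENNReal.ofReal_div_of_pos (by exact_mod_cast hm), ENNReal.ofReal_sub _ (by positivity),
          ENNReal.ofReal_natCast, ENNReal.ofReal_natCast, ENNReal.div_eq_inv_mul,
          ENNReal.natCast_sub]

/-- The method on `ℓ_1^m` which evaluates all coordinates if `all ω` holds, and nothing
otherwise. -/
noncomputable def allOrNothingMethod (m : ℕ) (all : Ω → Bool) :
    VaryingMonteCarloMethod Ω (PiLp 1 fun _ : Fin m => ℝ) (PiLp 1 fun _ : Fin m => ℝ) where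
  functional ω k _ := if h : all ω = true ∧ k < m then PiLp.proj 1 (fun _ => ℝ) ⟨k, h.2⟩ else 0
  output ω y := WithLp.toLp 1 fun i => if all ω = true then y i else 0
  measurable_functional k f := by
    refine measurable_from_prod_countable_right fun ω => ?_
    exact measurable_const (a := (if h : all ω = true ∧ k < m then
      PiLp.proj 1 (fun _ => ℝ) ⟨k, h.2⟩ else (0 : (PiLp 1 fun _ : Fin m => ℝ) →L[ℝ] ℝ)) f)
  measurable_info := by
    refine measurable_from_prod_countable_right fun ω => measurable_pi_iff.2 fun k => ?_
    exact (if h : all ω = true ∧ k < m then PiLp.proj 1 (fun _ => ℝ) ⟨k, h.2⟩ else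
      (0 : (PiLp 1 fun _ : Fin m => ℝ) →L[ℝ] ℝ)).continuous.measurable
  measurable_output := by
    refine measurable_from_prod_countable_right fun ω => Continuous.measurable ?_
    refine (PiLp.continuous_toLp 1 _).comp (continuous_pi fun i => ?_)
    dsimp only
    split_ifs
    · exact (if h : all ω = true ∧ i.val < m then PiLp.proj 1 (fun _ => ℝ) ⟨i.val, h.2⟩ else
        (0 : (PiLp 1 fun _ : Fin m => ℝ) →L[ℝ] ℝ)).continuous
    · exact continuous_const

lemma allOrNothingMethod_isHomogeneous (m : ℕ) (all : Ω → Bool) :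
    (allOrNothingMethod m all).IsHomogeneous := by
  refine ⟨fun _ _ _ _ _ => rfl, fun ω f c => ?_⟩
  ext i
  by_cases h : all ω = true <;> simp [allOrNothingMethod, h]

lemma allOrNothingMethod_eval (m : ℕ) (all : Ω → Bool) (ω : Ω) (f : PiLp 1 fun _ : Fin m => ℝ) :
    (allOrNothingMethod m all).eval ω f = if all ω = true then f else 0 := by
  ext i
  by_cases h : all ω = true <;>
    simp [VaryingMonteCarloMethod.eval, allOrNothingMethod, infoSequence, h]

lemma infoCount_allOrNothingMethod_le (m : ℕ) (all : Ω → Bool) (ω : Ω)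
    (f : PiLp 1 fun _ : Fin m => ℝ) :
    infoCount ((allOrNothingMethod m all).functional ω) f ≤
      ((if all ω = true then m else 0 : ℕ) : ℕ∞) := by
  refine iInf₂_le _ fun k hk => ?_
  have h : ¬ (all ω = true ∧ k < m) := fun h => by
    rw [if_pos h.1] at hk
    exact absurd h.2 hk.not_gt
  exact dif_neg h

/-- Full information is bought with probability p = min(nbar/m, 1). The expected cardinality is at
most pm ≤ nbar, and the expected error is (1 - p)‖f‖. -/
lemma homMonteCarloErrorVarying_id_le (hm : 1 ≤ m) (nbar : ℝ≥0) :
    homMonteCarloErrorVarying.{0, 0, w} nbar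
        (ContinuousLinearMap.id ℝ (PiLp 1 fun _ : Fin m => ℝ)) ≤
      ENNReal.ofReal (max (((m : ℝ) - nbar) / m) 0) := by
  have hm0 : (m : ℝ≥0∞) ≠ 0 := by simp; omega
  have hm1 : (m : ℝ) ≠ 0 := by norm_cast; omega
  set p : ℝ≥0∞ := min (nbar / m) 1 with hp
  have hp1 : p ≤ 1 := min_le_right _ _
  let P : Measure (ULift.{w} Bool) := p • Measure.dirac ⟨true⟩ + (1 - p) • Measure.dirac ⟨false⟩
  have hP : ∀ g : ULift.{w} Bool → ℝ≥0∞,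
      ∫⁻ ω, g ω ∂P = p * g ⟨true⟩ + (1 - p) * g ⟨false⟩ := fun g => by
    simp [P, lintegral_add_measure, lintegral_smul_measure, lintegral_dirac]
  have : IsProbabilityMeasure P := ⟨by
    rw [← lintegral_one, hP, mul_one, mul_one, add_tsub_cancel_of_le hp1]⟩
  have hcard : (allOrNothingMethod m (ULift.down.{w} (α := Bool))).card P ≤ nbar := by
    refine iSup₂_le fun f _ => ?_
    have h := fun b : Bool => ENat.toENNReal_le.2
      (infoCount_allOrNothingMethod_le m (ULift.down.{w} (α := Bool)) ⟨b⟩ f)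
    rw [hP]
    calc _ ≤ p * m + (1 - p) * 0 := by
          gcongr
          · simpa using h true
          · simpa using h false
      _ ≤ nbar / m * m := by
          rw [mul_zero, add_zero]
          gcongr
          exact min_le_left _ _
      _ = nbar := ENNReal.div_mul_cancel hm0 (by simp)
  refine (homMonteCarloErrorVarying_le (allOrNothingMethod_isHomogeneous m _) P hcard _).trans
    (iSup₂_le fun f hf => ?_)
  have hf' : ‖f‖ₑ ≤ 1 := by
    rw [mem_closedBall_zero_iff] at hf
    rwa [← ofReal_norm, ENNReal.ofReal_le_one]
  have h1p : 1 - p = ENNReal.ofReal (max (((m : ℝ) - nbar) / m) 0) := by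
    rw [hp, min_comm, tsub_min, ENNReal.ofReal_max, ENNReal.ofReal_zero, max_eq_left zero_le, sub_div,
      div_self hm1, ENNReal.ofReal_sub _ (by positivity), ENNReal.ofReal_one,
      ENNReal.ofReal_div_of_pos (by exact_mod_cast hm), ENNReal.ofReal_natCast,
      ENNReal.ofReal_coe_nnreal]
  rw [hP, ← h1p]
  simp only [allOrNothingMethod_eval]
  simpa using mul_le_of_le_one_right zero_le hf'

end Sharpness

/-! ### Assembly of the theorem -/

theorem mainTheorem10
    {F : Type u} [NormedAddCommGroup F] [NormedSpace ℝ F] [CompleteSpace F]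
    [MeasurableSpace F] [BorelSpace F]
    {G : Type v} [NormedAddCommGroup G] [NormedSpace ℝ G] [CompleteSpace G]
    [MeasurableSpace G] [BorelSpace G]
    (S : F →L[ℝ] G) (hS : IsCompactOperator S) :
    -- the lower bound by Bernstein numbers for fixed cardinality
    (∀ n m : ℕ, n < m →
      ENNReal.ofReal (((m : ℝ) - n) / m) * bernsteinNumber S m ≤
        homMonteCarloError.{u, v, w} n S) ∧
    -- the lower bound by Gaussian measures
    (∀ n m : ℕ, n ≤ m → ∀ J : EuclideanSpace ℝ (Fin m) →ₗ[ℝ] F, Function.Injective J →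
      (⨅ (K : Submodule ℝ (EuclideanSpace ℝ (Fin m))) (_ : Module.finrank ℝ K = m - n),
        (∫⁻ x, ‖S (J (K.starProjection x))‖ₑ ∂(stdGaussian (EuclideanSpace ℝ (Fin m)))) /
          (∫⁻ x, ‖J x‖ₑ ∂(stdGaussian (EuclideanSpace ℝ (Fin m))))) ≤
        homMonteCarloError.{u, v, w} n S) ∧
    -- the lower bound by Bernstein numbers for varying cardinality
    (∀ (nbar : ℝ≥0) (m : ℕ), 1 ≤ m →
      ENNReal.ofReal (max (((m : ℝ) - nbar) / m) 0) * bernsteinNumber S m ≤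
        homMonteCarloErrorVarying.{u, v, w} nbar S) ∧
    -- sharpness: equality holds for the identity of `ℓ_1^m`
    (∀ m : ℕ, 1 ≤ m →
      bernsteinNumber (ContinuousLinearMap.id ℝ (PiLp 1 fun _ : Fin m => ℝ)) m = 1 ∧
      (∀ n : ℕ,
        homMonteCarloError.{0, 0, w} n
            (ContinuousLinearMap.id ℝ (PiLp 1 fun _ : Fin m => ℝ)) =
          ENNReal.ofReal (max (((m : ℝ) - n) / m) 0)) ∧
      (∀ nbar : ℝ≥0,
        homMonteCarloErrorVarying.{0, 0, w} nbar
            (ContinuousLinearMap.id ℝ (PiLp 1 fun _ : Fin m => ℝ)) =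
          ENNReal.ofReal (max (((m : ℝ) - nbar) / m) 0))) := by
  refine ⟨fun n m => ofReal_mul_bernsteinNumber_le_homMonteCarloError S,
    fun n m _ => iInf_gaussianMean_div_le_homMonteCarloError S n,
    fun nbar m => ofReal_mul_bernsteinNumber_le_homMonteCarloErrorVarying S nbar,
    fun m hm => ?_⟩
  have hb : bernsteinNumber (ContinuousLinearMap.id ℝ (PiLp 1 fun _ : Fin m => ℝ)) m = 1 := by
    refine bernsteinNumber_id_of_rank_eq hm ?_
    rw [← Module.finrank_eq_rank, (WithLp.linearEquiv 1 ℝ (Fin m → ℝ)).finrank_eq,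
      Module.finrank_fin_fun]
  refine ⟨hb, fun n => le_antisymm (homMonteCarloError_id_le hm n) ?_,
    fun nbar => le_antisymm (homMonteCarloErrorVarying_id_le hm nbar) ?_⟩
  · rcases lt_or_ge n m with hnm | hnm
    · have h := ofReal_mul_bernsteinNumber_le_homMonteCarloError.{0, 0, w}
        (ContinuousLinearMap.id ℝ (PiLp 1 fun _ : Fin m => ℝ)) hnm
      rw [hb, mul_one] at h
      rwa [ENNReal.ofReal_max, ENNReal.ofReal_zero, max_eq_left zero_le]
    · have h : ((m : ℝ) - n) / m ≤ 0 :=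
        div_nonpos_of_nonpos_of_nonneg (by simpa using hnm) (by positivity)
      rw [max_eq_right h, ENNReal.ofReal_zero]
      exact zero_le
  · have h := ofReal_mul_bernsteinNumber_le_homMonteCarloErrorVarying.{0, 0, w}
      (ContinuousLinearMap.id ℝ (PiLp 1 fun _ : Fin m => ℝ)) nbar hm
    rwa [hb, mul_one] at h
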